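/- Let $\mathbb T^d=\mathbb R^d/\mathbb Z^d$ with Haar probability measure; for an integrable $h$ on $\mathbb T^D$ put $\hat h(\xi)=\int h(x)e^{-2\pi i\xi\cdot x}\,dx$ and $\|h\|_{\hat l^\infty}=\sup_{\xi\in\mathbb Z^D}|\hat h(\xi)|$. There exist a universal constant $C_1$ and constants $c_j$, $j\ge 1$, depending only on $j$, such that the following holds for every dimension $d$ and every continuous kernel $K:\mathbb T^d\times\mathbb T^d\to\mathbb R^d$ with summable Fourier modes, $\sum_{\lambda,\eta\in\mathbb Z^d}|\hat K(\lambda,\eta)|<\infty$. There is a constant $C=C(K)$ such that for every $\sigma>C$, every probability density $\rho_0\in L^2(\mathbb T^d)$ and every $N\ge1$: let $\rho=(\rho_t)_{t\ge0}$ be a weak solution of the McKean–Vlasov equation $$\partial_t\rho-\sigma\Delta\rho+\mathrm{div}\Big(\rho\int_{\mathbb T^d}K(x,y)\rho(y)\,dy\Big)=0,\qquad \rho|_{t=0}=\rho_0,$$ let $f_N=(f_N(t))_{t\ge0}$ be a weak solution on $(\mathbb T^d)^N$ of the Liouville equation $$\partial_tf_N+\sum_{i=1}^N\mathrm{div}_{x_i}\Big(f_N\,\frac1N\sum_{j=1}^NK(x_i,x_j)\Big)=\sigma\sum_{i=1}^N\Delta_{x_i}f_N,\qquad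 f_N|_{t=0}=\rho_0^{\otimes N},$$ let $f_{P,N}$, $P\subset\{1,\dots,N\}$, be the marginal of $f_N$ in the variables $(x_k)_{k\in P}$, write $[m]=\{1,\dots,m\}$, and let $$g_{[m],N}=\sum_{\pi\vdash[m]}(-1)^{|\pi|-1}(|\pi|-1)!\prod_{P\in\pi}f_{P,N}$$ be the correlation functions, where $\pi$ ranges over the partitions of $[m]$ (so $g_{[1],N}=f_{[1],N}$). Then for all $t\ge0$ $$\|g_{[1],N}(t)-\rho_t\|_{\hat l^\infty}\le\frac{C_1}{N},$$ and, for every $1\le j\le N$ and all $t\ge 0$, $$\|f_{[j],N}(t)-\rho_t^{\otimes j}\|_{\hat l^\infty}\le\frac{c_j}{N}.$$ Here weak solutions are weakly continuous curves $t\mapsto f_t\in L^1$ on $[0,\infty)$, bounded in $L^1$ locally in time, which satisfy the equation tested against every $C^\infty$ function on the torus, integrated in time. -/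

import Mathlib

open MeasureTheory
open scoped ENNReal ContDiff

noncomputable section

/-- The circle `ℝ/ℤ` carries the Haar measure of total mass `1`: the normalisation which Mathlib
uses for the Fourier coefficients on `UnitAddTorus`, through a local instance. -/
instance unitAddCircleMeasureSpace : MeasureSpace UnitAddCircle := ⟨AddCircle.haarAddCircle⟩

instance unitAddCircle_isAddHaarMeasure :
    Measure.IsAddHaarMeasure (volume : Measure UnitAddCircle) :=
  inferInstanceAs (Measure.IsAddHaarMeasure AddCircle.haarAddCircle)

instance unitAddCircle_isProbabilityMeasure :
    IsProbabilityMeasure (volume : Measure UnitAddCircle) :=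
  inferInstanceAs (IsProbabilityMeasure AddCircle.haarAddCircle)

/-- A test function on the torus `𝕋^J`: its `ℤ^J`-periodic lift to `ℝ^J` is `C^∞`. -/
def TorusSmooth {J : Type*} [Fintype J] (φ : UnitAddTorus J → ℝ) : Prop :=
  ContDiff ℝ ∞ (fun y : J → ℝ => φ (fun j => (y j : UnitAddCircle)))

/-- The partial derivative `∂_j φ` of a function on the torus `𝕋^J`. -/
def torusPartial {J : Type*} [DecidableEq J] (j : J) (φ : UnitAddTorus J → ℝ) :
    UnitAddTorus J → ℝ :=
  fun x => deriv (fun s : ℝ => φ (Function.update x j (x j + (s : UnitAddCircle)))) 0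

/-- The Laplacian `Δφ = ∑_j ∂_j ∂_j φ` on the torus `𝕋^J`. -/
def torusLaplacian {J : Type*} [Fintype J] [DecidableEq J] (φ : UnitAddTorus J → ℝ) :
    UnitAddTorus J → ℝ :=
  fun x => ∑ j, torusPartial j (torusPartial j φ) x

/-- The norm `‖h‖_{\hat l^∞} = sup_ξ |ĥ(ξ)|` of a real function on the torus `𝕋^J`, where
`ĥ(ξ) = ∫ h(x) e^{-2πi ξ·x} dx`. -/
def hatNorm {J : Type*} [Fintype J] (h : UnitAddTorus J → ℝ) : ℝ≥0∞ :=
  ⨆ ξ : J → ℤ, ‖UnitAddTorus.mFourierCoeff (fun x => (h x : ℂ)) ξ‖ₑ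

/-- `h` is a probability density on the torus `𝕋^J`. -/
structure IsProbDensity {J : Type*} [Fintype J] (h : UnitAddTorus J → ℝ) : Prop where
  integrable : Integrable h volume
  nonneg : 0 ≤ᵐ[volume] h
  integral_eq_one : ∫ x, h x = 1

/-- `f = (f_t)_{t ≥ 0}` is a weak solution of the Fokker-Planck equation
`∂_t f + div (f b_t) = σ Δ f` on `[0, ∞) × 𝕋^J`, in the class of weakly continuous curves in
`L^1`, locally bounded in time. The solution may be signed: neither nonnegativity nor
conservation of mass is part of the definition. -/
structure IsWeakFokkerPlanck {J : Type*} [Fintype J] [DecidableEq J] (σ : ℝ)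
    (b : ℝ → UnitAddTorus J → J → ℝ) (f : ℝ → UnitAddTorus J → ℝ) : Prop where
  integrable : ∀ t, 0 ≤ t → Integrable (f t) volume
  locally_bounded : ∀ T : ℝ, ∃ M : ℝ, ∀ t, 0 ≤ t → t ≤ T → ∫ x, |f t x| ≤ M
  weakly_continuous : ∀ φ : UnitAddTorus J → ℝ, Continuous φ →
    ContinuousOn (fun t => ∫ x, φ x * f t x) (Set.Ici 0)
  weak_equation : ∀ φ : UnitAddTorus J → ℝ, TorusSmooth φ → ∀ t, 0 ≤ t →
    ∫ x, φ x * f t x = (∫ x, φ x * f 0 x) +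
      ∫ s in (0 : ℝ)..t, ∫ x,
        (σ * torusLaplacian φ x + ∑ j, b s x j * torusPartial j φ x) * f s x

/-- The configuration space `(𝕋^d)^ι` of particles labelled by `ι`. -/
abbrev Config (d : ℕ) (ι : Type*) : Type _ := UnitAddTorus (ι × Fin d)

/-- The position `x_k ∈ 𝕋^d` of the particle `k`. -/
def particle {d : ℕ} {ι : Type*} (x : Config d ι) (k : ι) : UnitAddTorus (Fin d) :=
  fun i => x (k, i)

/-- The tensor power `h^{⊗ι}` on `(𝕋^d)^ι`. -/
def tensorPower {d : ℕ} (ι : Type*) [Fintype ι] (h : UnitAddTorus (Fin d) → ℝ) :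
    Config d ι → ℝ :=
  fun x => ∏ k : ι, h (particle x k)

/-- The Fourier mode `K̂(λ, η) ∈ ℂ^d` of a kernel `K : 𝕋^d × 𝕋^d → ℝ^d`. -/
def kernelMode {d : ℕ}
    (K : UnitAddTorus (Fin d) → UnitAddTorus (Fin d) → EuclideanSpace ℝ (Fin d))
    (lam eta : Fin d → ℤ) : EuclideanSpace ℂ (Fin d) :=
  WithLp.toLp 2 fun i =>
    UnitAddTorus.mFourierCoeff
      (fun z : UnitAddTorus (Fin d ⊕ Fin d) =>
        ((K (fun a => z (Sum.inl a)) (fun a => z (Sum.inr a)) i : ℝ) : ℂ))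
      (Sum.elim lam eta)

/-- `f` is a weak solution of the Liouville equation
`∂_t f + ∑_k div_{x_k} (f (1/N) ∑_l K(x_k, x_l)) = σ ∑_k Δ_{x_k} f` on `(𝕋^d)^N` with initial
datum `ρ₀^{⊗N}`. -/
structure IsLiouvilleSolution {d : ℕ} (N : ℕ) (σ : ℝ)
    (K : UnitAddTorus (Fin d) → UnitAddTorus (Fin d) → EuclideanSpace ℝ (Fin d))
    (ρ₀ : UnitAddTorus (Fin d) → ℝ) (f : ℝ → Config d (Fin N) → ℝ) : Prop where
  initial : f 0 =ᵐ[volume] tensorPower (Fin N) ρ₀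
  equation : IsWeakFokkerPlanck σ
    (fun _ x p => (1 / (N : ℝ)) * ∑ l : Fin N, K (particle x p.1) (particle x l) p.2) f

/-- `ρ` is a weak solution of the McKean-Vlasov equation
`∂_t ρ - σ Δ ρ + div (ρ ∫ K(x, y) ρ(y) dy) = 0` on `𝕋^d` with initial datum `ρ₀`. -/
structure IsMcKeanVlasovSolution {d : ℕ} (σ : ℝ)
    (K : UnitAddTorus (Fin d) → UnitAddTorus (Fin d) → EuclideanSpace ℝ (Fin d))
    (ρ₀ : UnitAddTorus (Fin d) → ℝ) (ρ : ℝ → UnitAddTorus (Fin d) → ℝ) : Prop where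
  initial : ρ 0 =ᵐ[volume] ρ₀
  equation : IsWeakFokkerPlanck σ (fun t x i => ∫ y, K x y i * ρ t y) ρ

/-- The marginal `f_P` on `(𝕋^d)^P` of a function `f` on `(𝕋^d)^ι`: the variables `x_k` with
`k ∉ P` are integrated out. -/
def marginal {d : ℕ} {ι : Type*} [Fintype ι] [DecidableEq ι] (f : Config d ι → ℝ)
    (P : Finset ι) : Config d P → ℝ :=
  fun x => ∫ z : Config d {k : ι // k ∉ P},
    f (fun p => if h : p.1 ∈ P then x (⟨p.1, h⟩, p.2) else z (⟨p.1, h⟩, p.2))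

/-- The correlation function
`g_P = ∑_{π ⊢ P} (-1)^{|π| - 1} (|π| - 1)! ∏_{Q ∈ π} f_Q` on `(𝕋^d)^P`. -/
def correlation {d : ℕ} {ι : Type*} [Fintype ι] [DecidableEq ι] (f : Config d ι → ℝ)
    (P : Finset ι) : Config d P → ℝ :=
  fun x => ∑ π : Finpartition P,
    (-1 : ℝ) ^ (π.parts.card - 1) * (Nat.factorial (π.parts.card - 1) : ℝ) *
      ∏ Q ∈ π.parts.attach, marginal f Q.1 (fun p => x (⟨p.1.1, π.le Q.2 p.1.2⟩, p.2))

/-- The index set `[m] = {1, …, m}`, as the set of the first `m` of the `N` particles. -/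
def firstParticles (N m : ℕ) : Finset (Fin N) := Finset.univ.filter fun k => k.val < m

end

/-! Everything happens on Fourier modes. Testing with trigonometric monomials turns both equations
into infinite systems of ODEs `u' = -κ u - D`, where `κ = 4π²σ|ξ|²` and `D = 2πi ∑ ξ_j v_j` comes
from the drift `v`. Since `|ξ_j| ≤ ξ_j²` for integers, a bound `|v_j| ≤ 2πσB` gives `|D| ≤ κB`, so
`|u|` never exceeds the larger of `B` and its initial size, uniformly in time and in `ξ`
(`norm_le_of_dissipative`, `norm_divergence_le`). Convolution with the kernel costs at most the
factor `A = ∑ |K̂|`, so for `σ > 2A/π` diffusion absorbs the drift with room to spare.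

This first bounds all modes of `ρ` and `f_N` by 1. The modes `F(Λ)` of `f_N` are then compared with
the products `∏_k r(Λ_k)` of modes of `ρ`. Let `D_m` be the supremum of the difference over times
and over modes `Λ` involving at most `m` particles. In the drift of a particle `k` of `Λ`, a partner
`l` outside `Λ` reproduces the mean-field drift up to `D_{m+1}`, and each of the at most `m`
partners inside costs at most 2, with weight `1/N`. Hence `D_m ≤ (2m/N + D_{m+1})/2`. This hierarchy
does not close, but the factor `1/2` lets it be iterated from the trivial bound 2: `D_m ≤ 2(m+1)/N +
2/2^n` for all `n` (`norm_torusCoeff_sub_productMode_le`). Modes of a marginal are modes of `f_N`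
extended by zero, which gives the theorem. -/

/-- The Fourier coefficient of a real function on the torus. -/
noncomputable def torusCoeff {J : Type*} [Fintype J] (h : UnitAddTorus J → ℝ) (ξ : J → ℤ) : ℂ :=
  UnitAddTorus.mFourierCoeff (fun x => (h x : ℂ)) ξ

/-- The real trigonometric monomial `Re (c e^{2πi n·x})`. -/
noncomputable def trigMonomial {J : Type*} [Fintype J] (c : ℂ) (n : J → ℤ) (x : UnitAddTorus J) :
    ℝ := (c * UnitAddTorus.mFourier n x).re

/-! ### Fourier coefficients and trigonometric test functions -/

section FourierTools

variable {J : Type*} [Fintype J]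

lemma norm_mFourier_apply (n : J → ℤ) (x : UnitAddTorus J) : ‖UnitAddTorus.mFourier n x‖ = 1 := by
  simp [UnitAddTorus.mFourier, norm_prod, fourier_apply, Circle.norm_coe]

lemma continuous_trigMonomial (c : ℂ) (n : J → ℤ) : Continuous (trigMonomial c n) := by
  unfold trigMonomial; fun_prop

lemma integrable_mFourier_mul {h : UnitAddTorus J → ℝ} (hh : Integrable h volume) (n : J → ℤ) :
    Integrable (fun x => UnitAddTorus.mFourier n x * (h x : ℂ)) volume := by
  refine hh.ofReal.bdd_mul (c := 1) (UnitAddTorus.mFourier n).continuous.aestronglyMeasurable ?_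
  exact Filter.Eventually.of_forall fun x => (norm_mFourier_apply n x).le

lemma norm_torusCoeff_le (h : UnitAddTorus J → ℝ) (ξ : J → ℤ) :
    ‖torusCoeff h ξ‖ ≤ ∫ x, |h x| := by
  refine (norm_integral_le_integral_norm _).trans_eq ?_
  simp [norm_mFourier_apply]

lemma torusCoeff_congr {g h : UnitAddTorus J → ℝ} (H : g =ᵐ[volume] h) (ξ : J → ℤ) :
    torusCoeff g ξ = torusCoeff h ξ := by
  refine integral_congr_ae ?_
  filter_upwards [H] with x hx
  simp [hx]

lemma torusCoeff_zero (h : UnitAddTorus J → ℝ) : torusCoeff h 0 = ((∫ x, h x : ℝ) : ℂ) := by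
  simp [torusCoeff, UnitAddTorus.mFourierCoeff, UnitAddTorus.mFourier_zero, integral_complex_ofReal]

lemma torusCoeff_sub {g h : UnitAddTorus J → ℝ} (hg : Integrable g volume)
    (hh : Integrable h volume) (ξ : J → ℤ) :
    torusCoeff (fun x => g x - h x) ξ = torusCoeff g ξ - torusCoeff h ξ := by
  simp only [torusCoeff, UnitAddTorus.mFourierCoeff, smul_eq_mul]
  rw [← integral_sub (integrable_mFourier_mul hg _) (integrable_mFourier_mul hh _)]
  simp [mul_sub]

lemma torusCoeff_sum {α : Type*} (s : Finset α) {h : α → UnitAddTorus J → ℝ}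
    (hh : ∀ a ∈ s, Integrable (h a) volume) (ξ : J → ℤ) :
    torusCoeff (fun x => ∑ a ∈ s, h a x) ξ = ∑ a ∈ s, torusCoeff (h a) ξ := by
  simp only [torusCoeff, UnitAddTorus.mFourierCoeff, smul_eq_mul]
  rw [← integral_finsetSum _ fun a ha => integrable_mFourier_mul (hh a ha) _]
  simp [Finset.mul_sum]

lemma torusCoeff_const_mul (a : ℝ) (h : UnitAddTorus J → ℝ) (ξ : J → ℤ) :
    torusCoeff (fun x => a * h x) ξ = a * torusCoeff h ξ := by
  simp only [torusCoeff, UnitAddTorus.mFourierCoeff, smul_eq_mul]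
  rw [← integral_const_mul]
  congr 1; ext x; push_cast; ring

lemma integrable_trigMonomial_mul {h : UnitAddTorus J → ℝ} (hh : Integrable h volume)
    (c : ℂ) (n : J → ℤ) : Integrable (fun x => trigMonomial c n x * h x) volume := by
  have := ((integrable_mFourier_mul hh n).const_mul c).re
  refine this.congr (Filter.Eventually.of_forall fun x => ?_)
  simp [trigMonomial, ← mul_assoc]

lemma integral_trigMonomial_mul {h : UnitAddTorus J → ℝ} (hh : Integrable h volume)
    (c : ℂ) (ξ : J → ℤ) :
    ∫ x, trigMonomial c (-ξ) x * h x = (c * torusCoeff h ξ).re := by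
  have h1 := integral_re ((integrable_mFourier_mul hh (-ξ)).const_mul c)
  simp only [torusCoeff, UnitAddTorus.mFourierCoeff, smul_eq_mul]
  rw [← integral_const_mul]
  refine Eq.trans ?_ h1
  congr 1; ext x
  simp [trigMonomial, ← mul_assoc]

lemma torusSmooth_trigMonomial (c : ℂ) (n : J → ℤ) : TorusSmooth (trigMonomial c n) := by
  unfold TorusSmooth trigMonomial
  simp only [UnitAddTorus.mFourier, ContinuousMap.coe_mk, fourier_coe_apply]
  refine Complex.reCLM.contDiff.comp (contDiff_const.mul (contDiff_prod fun i _ => ?_))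
  refine ContDiff.cexp ?_
  refine ContDiff.div_const (contDiff_const.mul ?_) _
  exact Complex.ofRealCLM.contDiff.comp (contDiff_apply ℝ ℝ i)

variable [DecidableEq J]

lemma mFourier_update_add (n : J → ℤ) (x : UnitAddTorus J) (j : J) (s : ℝ) :
    UnitAddTorus.mFourier n (Function.update x j (x j + (s : UnitAddCircle))) =
      UnitAddTorus.mFourier n x * Complex.exp (2 * Real.pi * Complex.I * n j * s) := by
  have h1 : ∀ i, fourier (n i) (Function.update x j (x j + (s : UnitAddCircle)) i) =
      fourier (n i) (x i) *
        (if i = j then Complex.exp (2 * Real.pi * Complex.I * n j * s) else 1) := by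
    intro i
    by_cases h : i = j
    · subst h
      have h2 : fourier (n i) (s : UnitAddCircle) =
          Complex.exp (2 * Real.pi * Complex.I * n i * s) := by
        rw [fourier_coe_apply]; simp
      simp only [Function.update_self, if_true]
      rw [← h2]
      simp [fourier_apply, smul_add, AddCircle.toCircle_add]
    · simp [h]
  simp only [UnitAddTorus.mFourier, ContinuousMap.coe_mk, h1, Finset.prod_mul_distrib]
  simp

lemma torusPartial_trigMonomial (j : J) (c : ℂ) (n : J → ℤ) :
    torusPartial j (trigMonomial c n) = trigMonomial (c * (2 * Real.pi * Complex.I * n j)) n := by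
  ext x
  unfold torusPartial trigMonomial
  simp only [mFourier_update_add]
  have h1 : HasDerivAt (fun s : ℝ => c * (UnitAddTorus.mFourier n x *
      Complex.exp (2 * Real.pi * Complex.I * n j * s)))
      (c * (UnitAddTorus.mFourier n x * (2 * Real.pi * Complex.I * n j))) 0 := by
    have h2 : HasDerivAt (fun s : ℝ => 2 * Real.pi * Complex.I * n j * (s : ℂ))
        (2 * Real.pi * Complex.I * n j) 0 := by
      simpa using (Complex.ofRealCLM.hasDerivAt (x := (0 : ℝ))).const_mul
        (2 * Real.pi * Complex.I * n j)
    simpa using ((h2.cexp).const_mul (UnitAddTorus.mFourier n x)).const_mul c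
  have h3 := (Complex.reCLM.hasFDerivAt.comp_hasDerivAt (0 : ℝ) h1).deriv
  refine Eq.trans ?_ (h3.trans ?_)
  · rfl
  · simp only [Complex.reCLM_apply]
    congr 1; ring

lemma torusLaplacian_trigMonomial (c : ℂ) (n : J → ℤ) :
    torusLaplacian (trigMonomial c n) =
      trigMonomial (-(4 * Real.pi ^ 2 * ∑ j, (n j : ℂ) ^ 2) * c) n := by
  ext x
  simp only [torusLaplacian, torusPartial_trigMonomial]
  simp only [trigMonomial]
  rw [← Complex.re_sum]
  congr 1
  rw [← Finset.sum_mul]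
  congr 1
  rw [Finset.mul_sum, ← Finset.sum_neg_distrib, Finset.sum_mul]
  refine Finset.sum_congr rfl fun j _ => ?_
  linear_combination 4 * c * Real.pi ^ 2 * (n j : ℂ) ^ 2 * Complex.I_sq

end FourierTools

/-! ### From the weak equation to an ODE for each Fourier mode -/

section WeakEquation

variable {J : Type*} [Fintype J] [DecidableEq J] {σ : ℝ} {b : ℝ → UnitAddTorus J → J → ℝ}
  {f : ℝ → UnitAddTorus J → ℝ}

/-- The heat dissipation rate `4π²σ|ξ|²` of the Fourier mode `ξ`. -/
noncomputable def heatRate (σ : ℝ) (ξ : J → ℤ) : ℝ := 4 * Real.pi ^ 2 * σ * ∑ j, (ξ j : ℝ) ^ 2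

lemma IsWeakFokkerPlanck.continuousOn_torusCoeff (hf : IsWeakFokkerPlanck σ b f) (ξ : J → ℤ) :
    ContinuousOn (fun t => torusCoeff (f t) ξ) (Set.Ici 0) := by
  have h1 := hf.weakly_continuous _ (continuous_trigMonomial 1 (-ξ))
  have h2 := hf.weakly_continuous _ (continuous_trigMonomial (-Complex.I) (-ξ))
  have h3 : ContinuousOn (fun t => (((∫ x, trigMonomial 1 (-ξ) x * f t x : ℝ) : ℂ) +
      ((∫ x, trigMonomial (-Complex.I) (-ξ) x * f t x : ℝ) : ℂ) * Complex.I)) (Set.Ici 0) := by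
    fun_prop
  refine h3.congr fun t ht => ?_
  simp only
  rw [integral_trigMonomial_mul (hf.integrable t ht), integral_trigMonomial_mul (hf.integrable t ht)]
  apply Complex.ext <;> simp

/-- The weak equation is an integral equation in time, and its integrand is continuous once the
drift modes are, so the fundamental theorem of calculus applies. A right derivative is enough for
the growth estimate that uses it. -/
lemma IsWeakFokkerPlanck.hasDerivWithinAt_torusCoeff (hf : IsWeakFokkerPlanck σ b f) (ξ : J → ℤ)
    (hb : ∀ s, 0 ≤ s → ∀ j, Integrable (fun x => b s x j * f s x) volume)
    (hc : ∀ j, ContinuousOn (fun s => torusCoeff (fun x => b s x j * f s x) ξ) (Set.Ici 0))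
    {t : ℝ} (ht : 0 ≤ t) :
    HasDerivWithinAt (fun s => torusCoeff (f s) ξ)
      (-heatRate σ ξ * torusCoeff (f t) ξ -
        2 * Real.pi * Complex.I * ∑ j, ξ j * torusCoeff (fun x => b t x j * f t x) ξ)
      (Set.Ici t) t := by
  set G : ℝ → ℂ := fun s => -heatRate σ ξ * torusCoeff (f s) ξ -
        2 * Real.pi * Complex.I * ∑ j, ξ j * torusCoeff (fun x => b s x j * f s x) ξ with hG
  have hGc : ContinuousOn G (Set.Ici 0) := by
    have := hf.continuousOn_torusCoeff ξ
    fun_prop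
  -- Test functions are real: `c = 1` gives the real part of the mode and `c = -i` the imaginary
  -- part.
  have key : ∀ c : ℂ, ∀ s, 0 ≤ s → (c * torusCoeff (f s) ξ).re =
      (c * torusCoeff (f 0) ξ).re + ∫ r in (0 : ℝ)..s, (c * G r).re := by
    intro c s hs
    have h1 := hf.weak_equation _ (torusSmooth_trigMonomial c (-ξ)) s hs
    rw [integral_trigMonomial_mul (hf.integrable s hs),
      integral_trigMonomial_mul (hf.integrable 0 le_rfl)] at h1
    rw [h1]
    congr 1
    refine intervalIntegral.integral_congr fun r hr => ?_
    rw [Set.uIcc_of_le hs] at hr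
    have hr0 := hr.1
    have h2 : ∀ x, (σ * torusLaplacian (trigMonomial c (-ξ)) x +
        ∑ j, b r x j * torusPartial j (trigMonomial c (-ξ)) x) * f r x =
        σ * (trigMonomial (-(4 * Real.pi ^ 2 * ∑ j, (((-ξ) j : ℤ) : ℂ) ^ 2) * c) (-ξ) x * f r x) +
        ∑ j, trigMonomial (c * (2 * Real.pi * Complex.I * ((-ξ) j : ℤ))) (-ξ) x *
          (b r x j * f r x) := by
      intro x
      rw [torusLaplacian_trigMonomial, add_mul, Finset.sum_mul]
      congr 1
      · ring
      · refine Finset.sum_congr rfl fun j _ => ?_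
        rw [torusPartial_trigMonomial]; ring
    simp only [h2]
    rw [integral_add ((integrable_trigMonomial_mul (hf.integrable r hr0) _ _).const_mul _)
      (integrable_finsetSum _ fun j _ => integrable_trigMonomial_mul (hb r hr0 j) _ _),
      integral_const_mul, integral_trigMonomial_mul (hf.integrable r hr0),
      integral_finsetSum _ fun j _ => integrable_trigMonomial_mul (hb r hr0 j) _ _]
    simp only [integral_trigMonomial_mul (hb r hr0 _)]
    rw [← Complex.re_ofReal_mul, ← Complex.re_sum, ← Complex.add_re]
    congr 1
    simp only [hG, heatRate, Pi.neg_apply, Int.cast_neg, neg_sq]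
    rw [mul_sub, sub_eq_add_neg]
    congr 1
    · push_cast
      generalize ∑ j, (ξ j : ℂ) ^ 2 = X
      ring
    · simp only [Finset.mul_sum]
      rw [← Finset.sum_neg_distrib]
      exact Finset.sum_congr rfl fun j _ => by ring
  have der : ∀ c : ℂ, HasDerivWithinAt (fun s => (c * torusCoeff (f s) ξ).re) (c * G t).re
      (Set.Ici t) t := by
    intro c
    have hcc : ContinuousOn (fun r => (c * G r).re) (Set.Ici 0) :=
      Complex.continuous_re.comp_continuousOn (continuousOn_const.mul hGc)
    have h3 : HasDerivWithinAt (fun u => ∫ r in (0 : ℝ)..u, (c * G r).re) (c * G t).re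
        (Set.Ici t) t := by
      refine intervalIntegral.integral_hasDerivWithinAt_right (t := Set.Ioi t) ?_ ?_ ?_
      · refine (hcc.mono ?_).intervalIntegrable
        rw [Set.uIcc_of_le ht]; exact Set.Icc_subset_Ici_self
      · have hm : AEStronglyMeasurable (fun r => (c * G r).re) (volume.restrict (Set.Ici 0)) :=
          hcc.aestronglyMeasurable measurableSet_Ici
        exact ⟨Set.Ioi t, self_mem_nhdsWithin, hm.mono_set
          (Set.Ioi_subset_Ici_self.trans (Set.Ici_subset_Ici.2 ht))⟩
      · exact (hcc t ht).mono (Set.Ioi_subset_Ici_self.trans (Set.Ici_subset_Ici.2 ht))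
    refine (h3.const_add _).congr (fun s hs => key c s (ht.trans hs)) (key c t ht)
  have hre := (der 1).ofReal_comp
  have him := ((der (-Complex.I)).ofReal_comp).mul_const Complex.I
  have := hre.add him
  change HasDerivWithinAt _ (G t) _ _
  refine HasDerivWithinAt.congr_deriv (this.congr (fun s _ => ?_) ?_) ?_ <;>
  · apply Complex.ext <;> simp

end WeakEquation

/-! ### Multiplication by an absolutely convergent Fourier series -/

section Series

variable {J P : Type*} [Fintype J] {a : P → ℂ} {q : P → J → ℤ} {B : UnitAddTorus J → ℝ}
  {h : UnitAddTorus J → ℝ}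

lemma continuous_of_hasSum_mFourier (ha : Summable fun p => ‖a p‖)
    (hB : ∀ x, HasSum (fun p => a p * UnitAddTorus.mFourier (q p) x) (B x : ℂ)) :
    Continuous B := by
  have h1 : Continuous fun x => ∑' p, a p * UnitAddTorus.mFourier (q p) x :=
    continuous_tsum (fun p => by fun_prop) ha fun p x => by simp [norm_mFourier_apply]
  have h2 : B = fun x => (∑' p, a p * UnitAddTorus.mFourier (q p) x).re := by
    ext x; rw [(hB x).tsum_eq]; simp
  rw [h2]
  exact Complex.continuous_re.comp h1

lemma integrable_continuous_mul (hB : Continuous B) (hh : Integrable h volume) :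
    Integrable (fun x => B x * h x) volume := by
  obtain ⟨C, hC⟩ := isCompact_univ.exists_bound_of_continuousOn hB.continuousOn
  exact hh.bdd_mul (c := C) hB.aestronglyMeasurable
    (Filter.Eventually.of_forall fun x => hC x (Set.mem_univ x))

/-- Multiplication becomes convolution; summability of `a` and integrability of `h` justify
exchanging the series and the integral. -/
lemma hasSum_torusCoeff_mul [Countable P] (ha : Summable fun p => ‖a p‖)
    (hB : ∀ x, HasSum (fun p => a p * UnitAddTorus.mFourier (q p) x) (B x : ℂ))
    (hh : Integrable h volume) (ξ : J → ℤ) :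
    HasSum (fun p => a p * torusCoeff h (ξ - q p)) (torusCoeff (fun x => B x * h x) ξ) := by
  have h1 := hasSum_integral_of_summable_integral_norm (μ := volume)
    (F := fun p x => a p * (UnitAddTorus.mFourier (-(ξ - q p)) x * (h x : ℂ)))
    (fun p => (integrable_mFourier_mul hh _).const_mul _) ?_
  · have h2 : ∀ x, ∑' p, a p * (UnitAddTorus.mFourier (-(ξ - q p)) x * (h x : ℂ)) =
        UnitAddTorus.mFourier (-ξ) x * ((B x * h x : ℝ) : ℂ) := by
      intro x
      rw [Complex.ofReal_mul, ← (hB x).tsum_eq, ← tsum_mul_right, ← tsum_mul_left]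
      refine tsum_congr fun p => ?_
      rw [neg_sub, sub_eq_add_neg, UnitAddTorus.mFourier_add]
      ring
    simp only [h2, integral_const_mul] at h1
    exact h1
  · simp only [norm_mul, norm_mFourier_apply, one_mul]
    simp only [integral_const_mul]
    exact ha.mul_right _

end Series

/-! ### Fourier modes of the two drifts -/

section Kernel

variable {d : ℕ} {K : UnitAddTorus (Fin d) → UnitAddTorus (Fin d) → EuclideanSpace ℝ (Fin d)}

lemma norm_kernelMode_apply_le (p : (Fin d → ℤ) × (Fin d → ℤ)) (i : Fin d) :
    ‖kernelMode K p.1 p.2 i‖ ≤ ‖kernelMode K p.1 p.2‖ :=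
  PiLp.norm_apply_le (kernelMode K p.1 p.2) i

lemma summable_norm_kernelMode_apply
    (hs : Summable (fun p : (Fin d → ℤ) × (Fin d → ℤ) => ‖kernelMode K p.1 p.2‖)) (i : Fin d) :
    Summable (fun p : (Fin d → ℤ) × (Fin d → ℤ) => ‖kernelMode K p.1 p.2 i‖) :=
  Summable.of_nonneg_of_le (fun _ => norm_nonneg _) (fun p => norm_kernelMode_apply_le p i) hs

lemma hasSum_kernelMode
    (hK : Continuous (fun z : UnitAddTorus (Fin d) × UnitAddTorus (Fin d) => K z.1 z.2))
    (hs : Summable (fun p : (Fin d → ℤ) × (Fin d → ℤ) => ‖kernelMode K p.1 p.2‖))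
    (x y : UnitAddTorus (Fin d)) (i : Fin d) :
    HasSum (fun p : (Fin d → ℤ) × (Fin d → ℤ) => kernelMode K p.1 p.2 i *
      (UnitAddTorus.mFourier p.1 x * UnitAddTorus.mFourier p.2 y)) ((K x y i : ℝ) : ℂ) := by
  let k : C(UnitAddTorus (Fin d ⊕ Fin d), ℂ) :=
    ⟨fun z => ((K (fun a => z (Sum.inl a)) (fun a => z (Sum.inr a)) i : ℝ) : ℂ), by
      have h1 : Continuous fun z : UnitAddTorus (Fin d ⊕ Fin d) =>
          ((fun a => z (Sum.inl a), fun a => z (Sum.inr a)) :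
            UnitAddTorus (Fin d) × UnitAddTorus (Fin d)) := by fun_prop
      have h2 := hK.comp h1
      have h3 : Continuous fun v : EuclideanSpace ℝ (Fin d) => v i := by fun_prop
      exact Complex.continuous_ofReal.comp (h3.comp h2)⟩
  let e := Equiv.sumArrowEquivProdArrow (Fin d) (Fin d) ℤ
  have hcoef : ∀ p : (Fin d → ℤ) × (Fin d → ℤ),
      UnitAddTorus.mFourierCoeff k (e.symm p) = kernelMode K p.1 p.2 i := fun p => rfl
  have hsum : Summable (UnitAddTorus.mFourierCoeff k) := by
    rw [← e.symm.summable_iff]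
    refine Summable.of_norm ?_
    simpa [Function.comp_def, hcoef] using summable_norm_kernelMode_apply hs i
  have h1 := UnitAddTorus.hasSum_mFourier_series_apply_of_summable hsum (Sum.elim x y)
  rw [← e.symm.hasSum_iff] at h1
  have hk : k (Sum.elim x y) = ((K x y i : ℝ) : ℂ) := rfl
  rw [hk] at h1
  convert h1 using 2 with p
  simp only [Function.comp_apply, hcoef, smul_eq_mul]
  congr 1
  simp [UnitAddTorus.mFourier, e, Equiv.sumArrowEquivProdArrow]

/-- The Fourier mode `λ` of the particle `k` plus the Fourier mode `η` of the particle `l`. -/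
def pairMode {ι : Type*} [DecidableEq ι] (k l : ι) (p : (Fin d → ℤ) × (Fin d → ℤ)) :
    ι × Fin d → ℤ :=
  fun q => (if q.1 = k then p.1 q.2 else 0) + (if q.1 = l then p.2 q.2 else 0)

lemma mFourier_single_particle {ι : Type*} [Fintype ι] [DecidableEq ι] (k : ι) (ξ : Fin d → ℤ)
    (x : Config d ι) :
    UnitAddTorus.mFourier (fun q : ι × Fin d => if q.1 = k then ξ q.2 else 0) x =
      UnitAddTorus.mFourier ξ (particle x k) := by
  simp only [UnitAddTorus.mFourier, ContinuousMap.coe_mk, Fintype.prod_prod_type]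
  rw [Finset.prod_eq_single k]
  · simp [particle]
  · intro l _ hl; simp [hl]
  · simp

lemma mFourier_pairMode {ι : Type*} [Fintype ι] [DecidableEq ι] (k l : ι)
    (p : (Fin d → ℤ) × (Fin d → ℤ)) (x : Config d ι) :
    UnitAddTorus.mFourier (pairMode k l p) x =
      UnitAddTorus.mFourier p.1 (particle x k) * UnitAddTorus.mFourier p.2 (particle x l) := by
  rw [← mFourier_single_particle, ← mFourier_single_particle, ← UnitAddTorus.mFourier_add]
  rfl

variable (hK : Continuous (fun z : UnitAddTorus (Fin d) × UnitAddTorus (Fin d) => K z.1 z.2))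
  (hs : Summable (fun p : (Fin d → ℤ) × (Fin d → ℤ) => ‖kernelMode K p.1 p.2‖))

include hK hs

lemma hasSum_kernel_particle {ι : Type*} [Fintype ι] [DecidableEq ι] (k l : ι) (i : Fin d)
    (x : Config d ι) :
    HasSum (fun p : (Fin d → ℤ) × (Fin d → ℤ) => kernelMode K p.1 p.2 i *
      UnitAddTorus.mFourier (pairMode k l p) x) ((K (particle x k) (particle x l) i : ℝ) : ℂ) := by
  simpa only [mFourier_pairMode] using hasSum_kernelMode hK hs (particle x k) (particle x l) i

lemma torusCoeff_liouville_drift {N : ℕ} {h : Config d (Fin N) → ℝ} (hh : Integrable h volume)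
    (k : Fin N) (i : Fin d) (Λ : Fin N × Fin d → ℤ) :
    Integrable (fun x => (1 / (N : ℝ)) * (∑ l : Fin N, K (particle x k) (particle x l) i) * h x)
        volume ∧
      torusCoeff (fun x => (1 / (N : ℝ)) * (∑ l : Fin N, K (particle x k) (particle x l) i) * h x) Λ
        = (1 / (N : ℂ)) * ∑ l : Fin N, ∑' p : (Fin d → ℤ) × (Fin d → ℤ),
          kernelMode K p.1 p.2 i * torusCoeff h (Λ - pairMode k l p) := by
  have ha := summable_norm_kernelMode_apply hs i
  have hi : ∀ l : Fin N, Integrable (fun x => K (particle x k) (particle x l) i * h x) volume :=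
    fun l => integrable_continuous_mul
      (continuous_of_hasSum_mFourier ha (hasSum_kernel_particle hK hs k l i)) hh
  have heq : (fun x => (1 / (N : ℝ)) * (∑ l : Fin N, K (particle x k) (particle x l) i) * h x) =
      fun x => (1 / (N : ℝ)) * ∑ l : Fin N, K (particle x k) (particle x l) i * h x := by
    ext x; rw [mul_assoc, Finset.sum_mul]
  rw [heq]
  refine ⟨(integrable_finsetSum _ fun l _ => hi l).const_mul _, ?_⟩
  rw [torusCoeff_const_mul, torusCoeff_sum _ fun l _ => hi l]
  push_cast
  congr 1
  refine Finset.sum_congr rfl fun l _ => ?_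
  exact (hasSum_torusCoeff_mul ha (hasSum_kernel_particle hK hs k l i) hh Λ).tsum_eq.symm

/-- The convolution rule is used twice: at mode 0 in `y`, to expand the velocity field as a series
in `x`, and then at mode `ξ` in `x`. -/
lemma torusCoeff_mcKean_drift {h : UnitAddTorus (Fin d) → ℝ} (hh : Integrable h volume)
    (i : Fin d) (ξ : Fin d → ℤ) :
    Integrable (fun x => (∫ y, K x y i * h y) * h x) volume ∧
      torusCoeff (fun x => (∫ y, K x y i * h y) * h x) ξ =
        ∑' p : (Fin d → ℤ) × (Fin d → ℤ),
          kernelMode K p.1 p.2 i * (torusCoeff h (ξ - p.1) * torusCoeff h (-p.2)) := by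
  have ha := summable_norm_kernelMode_apply hs i
  have h1 : ∀ x, HasSum (fun p : (Fin d → ℤ) × (Fin d → ℤ) =>
      (kernelMode K p.1 p.2 i * torusCoeff h (-p.2)) * UnitAddTorus.mFourier p.1 x)
      ((∫ y, K x y i * h y : ℝ) : ℂ) := by
    intro x
    have h2 := hasSum_torusCoeff_mul (a := fun p : (Fin d → ℤ) × (Fin d → ℤ) =>
      kernelMode K p.1 p.2 i * UnitAddTorus.mFourier p.1 x) (q := fun p => p.2)
      (B := fun y => K x y i) (by simpa [norm_mFourier_apply] using ha)
      (fun y => by simpa only [mul_assoc] using hasSum_kernelMode hK hs x y i) hh 0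
    rw [torusCoeff_zero] at h2
    convert h2 using 2 with p
    rw [zero_sub]; ring
  have ha' : Summable fun p : (Fin d → ℤ) × (Fin d → ℤ) =>
      ‖kernelMode K p.1 p.2 i * torusCoeff h (-p.2)‖ := by
    refine Summable.of_nonneg_of_le (fun _ => norm_nonneg _) (fun p => ?_)
      (ha.mul_right (∫ x, |h x|))
    rw [norm_mul]
    gcongr
    exact norm_torusCoeff_le _ _
  refine ⟨integrable_continuous_mul (continuous_of_hasSum_mFourier ha' h1) hh, ?_⟩
  rw [← (hasSum_torusCoeff_mul ha' h1 hh ξ).tsum_eq]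
  refine tsum_congr fun p => by ring

end Kernel

/-! ### Dissipation against divergence-form forcing -/

section Dissipation

/-- With the integrating factor `e^{κ(t-a)}` only the forcing remains, and `e^{κ(t-a)}(P + α(t-a))`
grows at least as fast because `B ≤ P`. The bound does not depend on `κ`, hence is uniform over
modes; with `α = 0` it is also uniform in time. -/
lemma norm_le_of_dissipative {u D : ℝ → ℂ} {κ B α a b P : ℝ} (hκ : 0 ≤ κ) (hα : 0 ≤ α)
    (hc : ContinuousOn u (Set.Icc a b))
    (hd : ∀ t ∈ Set.Ico a b, HasDerivWithinAt u (-κ * u t - D t) (Set.Ici t) t)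
    (hD : ∀ t ∈ Set.Ico a b, ‖D t‖ ≤ κ * B + α) (ha : ‖u a‖ ≤ P) (hB : B ≤ P) :
    ∀ t ∈ Set.Icc a b, ‖u t‖ ≤ P + α * (t - a) := by
  have hE : ∀ t : ℝ, HasDerivAt (fun s : ℝ => Real.exp (κ * (s - a)))
      (Real.exp (κ * (t - a)) * κ) t := by
    intro t
    have h1 : HasDerivAt (fun s : ℝ => κ * (s - a)) κ t := by
      simpa using ((hasDerivAt_id t).sub_const a).const_mul κ
    exact h1.exp
  intro t ht
  have key := image_norm_le_of_norm_deriv_right_le_deriv_boundary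
    (f := fun s => (Real.exp (κ * (s - a)) : ℂ) * u s)
    (f' := fun s => -((Real.exp (κ * (s - a)) : ℂ) * D s))
    (B := fun s => Real.exp (κ * (s - a)) * (P + α * (s - a)))
    (B' := fun s => Real.exp (κ * (s - a)) * κ * (P + α * (s - a)) +
      Real.exp (κ * (s - a)) * α) (a := a) (b := b) ?_ ?_ ?_ ?_ ?_ ht
  · rw [norm_mul, Complex.norm_real, Real.norm_of_nonneg (Real.exp_pos _).le] at key
    exact le_of_mul_le_mul_left key (Real.exp_pos _)
  · exact ContinuousOn.mul (Continuous.continuousOn (by fun_prop)) hc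
  · intro s hs
    refine (((hE s).hasDerivWithinAt.ofReal_comp).mul (hd s hs)).congr_deriv ?_
    push_cast
    ring
  · simpa using ha
  · intro s
    refine (hE s).mul ?_
    simpa using (((hasDerivAt_id s).sub_const a).const_mul α).const_add P
  · intro s hs
    rw [norm_neg, norm_mul, Complex.norm_real, Real.norm_of_nonneg (Real.exp_pos _).le,
      mul_assoc, ← mul_add]
    refine mul_le_mul_of_nonneg_left ((hD s hs).trans ?_) (Real.exp_pos _).le
    have h1 : 0 ≤ α * (s - a) := mul_nonneg hα (sub_nonneg.2 hs.1)
    have h2 : κ * B ≤ κ * (P + α * (s - a)) := mul_le_mul_of_nonneg_left (by linarith) hκ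
    linarith

variable {J : Type*} [Fintype J]

lemma heatRate_nonneg {σ : ℝ} (hσ : 0 ≤ σ) (ξ : J → ℤ) : 0 ≤ heatRate σ ξ := by
  unfold heatRate; positivity

lemma abs_intCast_le_sq (n : ℤ) : |(n : ℝ)| ≤ (n : ℝ) ^ 2 := by
  rw [← Int.cast_abs, ← Int.cast_pow, Int.cast_le]
  rcases eq_or_ne n 0 with rfl | h
  · simp
  · have := Int.one_le_abs h
    rw [← sq_abs]; nlinarith

/-- One derivative on an integer frequency is dominated by two: `|ξ_j| ≤ ξ_j²`. Coordinates with
`ξ_j = 0` drop out, so `v_j` needs a bound only on the support of `ξ`. -/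
lemma norm_divergence_le {σ M B : ℝ} {ξ : J → ℤ} {v : J → ℂ} (hM : M ≤ 2 * Real.pi * σ * B)
    (hv : ∀ j, ξ j ≠ 0 → ‖v j‖ ≤ M) :
    ‖2 * Real.pi * Complex.I * ∑ j, ξ j * v j‖ ≤ heatRate σ ξ * B := by
  have h1 : ‖∑ j, (ξ j : ℂ) * v j‖ ≤ ∑ j, (ξ j : ℝ) ^ 2 * (2 * Real.pi * σ * B) := by
    refine norm_sum_le_of_le _ fun j _ => ?_
    rw [norm_mul, Complex.norm_intCast]
    by_cases h : ξ j = 0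
    · simp [h]
    · exact mul_le_mul (abs_intCast_le_sq _) ((hv j h).trans hM) (norm_nonneg _) (sq_nonneg _)
  rw [norm_mul]
  have h2 : ‖(2 * Real.pi * Complex.I : ℂ)‖ = 2 * Real.pi := by
    simp [abs_of_pos Real.pi_pos]
  rw [h2, heatRate]
  calc 2 * Real.pi * ‖∑ j, (ξ j : ℂ) * v j‖
      ≤ 2 * Real.pi * ∑ j, (ξ j : ℝ) ^ 2 * (2 * Real.pi * σ * B) := by
        gcongr
    _ = _ := by rw [← Finset.sum_mul]; ring

/-- Variant for a drift bound `M` of any size: `|n| ≤ n²/L + L` lets the heat rate absorb the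
frequency-dependent part with coefficient 1, leaving a constant independent of `ξ`. It controls
short times only. -/
lemma norm_divergence_le_add {σ M L : ℝ} {ξ : J → ℤ} {v : J → ℂ} (hL : 0 < L)
    (hM : M ≤ 2 * Real.pi * σ * L) (hv : ∀ j, ‖v j‖ ≤ M) :
    ‖2 * Real.pi * Complex.I * ∑ j, ξ j * v j‖ ≤
      heatRate σ ξ + 2 * Real.pi * (Fintype.card J * (L * (2 * Real.pi * σ * L))) := by
  have hn : ∀ n : ℝ, |n| ≤ n ^ 2 / L + L := by
    intro n
    rcases le_total |n| L with h | h
    · have : 0 ≤ n ^ 2 / L := by positivity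
      linarith
    · have : |n| ≤ n ^ 2 / L := by
        rw [le_div_iff₀ hL, ← sq_abs, sq]
        exact mul_le_mul_of_nonneg_left h (abs_nonneg _)
      linarith
  have h1 : ‖∑ j, (ξ j : ℂ) * v j‖ ≤ ∑ j, ((ξ j : ℝ) ^ 2 / L + L) * (2 * Real.pi * σ * L) := by
    refine norm_sum_le_of_le _ fun j _ => ?_
    rw [norm_mul, Complex.norm_intCast]
    exact mul_le_mul (hn _) ((hv j).trans hM) (norm_nonneg _) (by positivity)
  have h2 : ‖(2 * Real.pi * Complex.I : ℂ)‖ = 2 * Real.pi := by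
    simp [abs_of_pos Real.pi_pos]
  rw [norm_mul, h2, heatRate]
  calc 2 * Real.pi * ‖∑ j, (ξ j : ℂ) * v j‖
      ≤ 2 * Real.pi * ∑ j, ((ξ j : ℝ) ^ 2 / L + L) * (2 * Real.pi * σ * L) := by
        gcongr
    _ = _ := by
      rw [← Finset.sum_mul, Finset.sum_add_distrib, ← Finset.sum_div]
      simp only [Finset.sum_const, Finset.card_univ, nsmul_eq_mul]
      field_simp
      ring

lemma continuousOn_Ici_of_forall_Icc {E : Type*} [TopologicalSpace E] {g : ℝ → E}
    (h : ∀ T, ContinuousOn g (Set.Icc 0 T)) : ContinuousOn g (Set.Ici 0) := by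
  intro t ht
  refine (h (t + 1) t ⟨ht, by linarith⟩).mono_of_mem_nhdsWithin ?_
  rw [← Set.Ici_inter_Iic]
  exact inter_mem_nhdsWithin _ (Iic_mem_nhds (by linarith))

end Dissipation

/-! ### Bounds on the drift modes by the kernel mass -/

section Drift

variable {d : ℕ} (K : UnitAddTorus (Fin d) → UnitAddTorus (Fin d) → EuclideanSpace ℝ (Fin d))

/-- The sum `∑ |K̂(λ, η)|` of the norms of the Fourier modes of the kernel. -/
noncomputable def kernelMass : ℝ := ∑' p : (Fin d → ℤ) × (Fin d → ℤ), ‖kernelMode K p.1 p.2‖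

/-- The Fourier mode of the McKean-Vlasov drift, in terms of the modes `r` of the density. -/
noncomputable def mcKeanDrift (r : (Fin d → ℤ) → ℂ) (ξ : Fin d → ℤ) (i : Fin d) : ℂ :=
  ∑' p : (Fin d → ℤ) × (Fin d → ℤ), kernelMode K p.1 p.2 i * (r (ξ - p.1) * r (-p.2))

/-- The Fourier mode of the Liouville drift, in terms of the modes `F` of the density. -/
noncomputable def liouvilleDrift {N : ℕ} (F : (Fin N × Fin d → ℤ) → ℂ) (Λ : Fin N × Fin d → ℤ)
    (q : Fin N × Fin d) : ℂ :=
  (1 / (N : ℂ)) * ∑ l : Fin N, ∑' p : (Fin d → ℤ) × (Fin d → ℤ),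
    kernelMode K p.1 p.2 q.2 * F (Λ - pairMode q.1 l p)

variable {K}

lemma kernelMass_nonneg : 0 ≤ kernelMass K := tsum_nonneg fun _ => norm_nonneg _

lemma norm_kernelMode_mul_le {w : (Fin d → ℤ) × (Fin d → ℤ) → ℂ} {R : ℝ} (hw : ∀ p, ‖w p‖ ≤ R)
    (i : Fin d) (p : (Fin d → ℤ) × (Fin d → ℤ)) :
    ‖kernelMode K p.1 p.2 i * w p‖ ≤ ‖kernelMode K p.1 p.2‖ * R := by
  rw [norm_mul]
  exact mul_le_mul (norm_kernelMode_apply_le p i) (hw p) (norm_nonneg _) (norm_nonneg _)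

variable (hs : Summable (fun p : (Fin d → ℤ) × (Fin d → ℤ) => ‖kernelMode K p.1 p.2‖))

include hs

lemma summable_kernelMode_mul {w : (Fin d → ℤ) × (Fin d → ℤ) → ℂ} {R : ℝ} (hw : ∀ p, ‖w p‖ ≤ R)
    (i : Fin d) : Summable fun p => kernelMode K p.1 p.2 i * w p :=
  Summable.of_norm_bounded (hs.mul_right R) (norm_kernelMode_mul_le hw i)

lemma norm_tsum_kernelMode_mul_le {w : (Fin d → ℤ) × (Fin d → ℤ) → ℂ} {R : ℝ}
    (hw : ∀ p, ‖w p‖ ≤ R) (i : Fin d) :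
    ‖∑' p, kernelMode K p.1 p.2 i * w p‖ ≤ kernelMass K * R :=
  tsum_of_norm_bounded (hs.hasSum.mul_right R) (norm_kernelMode_mul_le hw i)

lemma continuousOn_tsum_kernelMode_mul {w : (Fin d → ℤ) × (Fin d → ℤ) → ℝ → ℂ} {R : ℝ}
    {s : Set ℝ} (hw : ∀ p, ∀ t ∈ s, ‖w p t‖ ≤ R) (hc : ∀ p, ContinuousOn (w p) s) (i : Fin d) :
    ContinuousOn (fun t => ∑' p, kernelMode K p.1 p.2 i * w p t) s :=
  continuousOn_tsum (fun p => continuousOn_const.mul (hc p)) (hs.mul_right R)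
    fun p t ht => norm_kernelMode_mul_le (w := fun p => w p t) (fun p => hw p t ht) i p

lemma norm_mcKeanDrift_le {r : (Fin d → ℤ) → ℂ} {R : ℝ} (hr : ∀ ξ, ‖r ξ‖ ≤ R) (ξ : Fin d → ℤ)
    (i : Fin d) : ‖mcKeanDrift K r ξ i‖ ≤ kernelMass K * R ^ 2 := by
  refine norm_tsum_kernelMode_mul_le hs (fun p => ?_) i
  rw [norm_mul, sq]
  exact mul_le_mul (hr _) (hr _) (norm_nonneg _) ((norm_nonneg _).trans (hr 0))

lemma norm_average_tsum_le {N : ℕ} (hN : 1 ≤ N)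
    {w : Fin N → (Fin d → ℤ) × (Fin d → ℤ) → ℂ} {R : Fin N → ℝ} (hw : ∀ l p, ‖w l p‖ ≤ R l)
    (i : Fin d) :
    ‖(1 / (N : ℂ)) * ∑ l : Fin N, ∑' p, kernelMode K p.1 p.2 i * w l p‖ ≤
      kernelMass K * ((∑ l, R l) / N) := by
  have hN' : (0 : ℝ) < N := by exact_mod_cast hN
  have h1 : ‖∑ l : Fin N, ∑' p, kernelMode K p.1 p.2 i * w l p‖ ≤ ∑ l, kernelMass K * R l :=
    norm_sum_le_of_le _ fun l _ => norm_tsum_kernelMode_mul_le hs (hw l) i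
  rw [norm_mul, norm_div, norm_one, Complex.norm_natCast]
  rw [← Finset.mul_sum] at h1
  calc 1 / (N : ℝ) * ‖∑ l : Fin N, ∑' p, kernelMode K p.1 p.2 i * w l p‖
      ≤ 1 / (N : ℝ) * (kernelMass K * ∑ l, R l) := by gcongr
    _ = _ := by ring

lemma norm_liouvilleDrift_le {N : ℕ} (hN : 1 ≤ N) {F : (Fin N × Fin d → ℤ) → ℂ} {R : ℝ}
    (hF : ∀ Λ, ‖F Λ‖ ≤ R) (Λ : Fin N × Fin d → ℤ) (q : Fin N × Fin d) :
    ‖liouvilleDrift K F Λ q‖ ≤ kernelMass K * R := by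
  have hN' : (N : ℝ) ≠ 0 := by positivity
  have := norm_average_tsum_le hs hN (w := fun l p => F (Λ - pairMode q.1 l p)) (R := fun _ => R)
    (fun l p => hF _) q.2
  have h1 : (∑ _l : Fin N, R) / (N : ℝ) = R := by simp [hN']
  rwa [h1] at this

end Drift

/-! ### A priori bounds for the McKean–Vlasov modes -/

section McKeanVlasov

variable {d : ℕ} {K : UnitAddTorus (Fin d) → UnitAddTorus (Fin d) → EuclideanSpace ℝ (Fin d)}
  {σ : ℝ} {ρ₀ : UnitAddTorus (Fin d) → ℝ} {ρ : ℝ → UnitAddTorus (Fin d) → ℝ}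

lemma IsWeakFokkerPlanck.exists_norm_torusCoeff_le {J : Type*} [Fintype J] [DecidableEq J]
    {b : ℝ → UnitAddTorus J → J → ℝ} {f : ℝ → UnitAddTorus J → ℝ}
    (hf : IsWeakFokkerPlanck σ b f) (T : ℝ) :
    ∃ M : ℝ, 0 ≤ M ∧ ∀ t ∈ Set.Icc 0 T, ∀ ξ, ‖torusCoeff (f t) ξ‖ ≤ M := by
  obtain ⟨M, hM⟩ := hf.locally_bounded T
  exact ⟨max 0 M, le_max_left _ _, fun t ht ξ =>
    (norm_torusCoeff_le _ _).trans ((hM t ht.1 ht.2).trans (le_max_right _ _))⟩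

lemma IsProbDensity.norm_torusCoeff_le_one {J : Type*} [Fintype J] {h : UnitAddTorus J → ℝ}
    (hh : IsProbDensity h) (ξ : J → ℤ) : ‖torusCoeff h ξ‖ ≤ 1 := by
  refine (norm_torusCoeff_le _ _).trans_eq ?_
  rw [← hh.integral_eq_one]
  refine integral_congr_ae ?_
  filter_upwards [hh.nonneg] with x hx
  exact abs_of_nonneg hx

variable (hK : Continuous (fun z : UnitAddTorus (Fin d) × UnitAddTorus (Fin d) => K z.1 z.2))
  (hs : Summable (fun p : (Fin d → ℤ) × (Fin d → ℤ) => ‖kernelMode K p.1 p.2‖))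

include hK hs

lemma IsMcKeanVlasovSolution.hasDerivWithinAt (hρ : IsMcKeanVlasovSolution σ K ρ₀ ρ)
    (ξ : Fin d → ℤ) {t : ℝ} (ht : 0 ≤ t) :
    HasDerivWithinAt (fun s => torusCoeff (ρ s) ξ)
      (-heatRate σ ξ * torusCoeff (ρ t) ξ -
        2 * Real.pi * Complex.I * ∑ i, ξ i * mcKeanDrift K (torusCoeff (ρ t)) ξ i)
      (Set.Ici t) t := by
  have h := hρ.equation
  have hdrift := fun s hs' => torusCoeff_mcKean_drift hK hs (h.integrable s hs')
  refine (h.hasDerivWithinAt_torusCoeff ξ (fun s hs' i => (hdrift s hs' i ξ).1) (fun i => ?_)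
    ht).congr_deriv ?_
  · refine ContinuousOn.congr (f := fun s => mcKeanDrift K (torusCoeff (ρ s)) ξ i) ?_
      fun s hs' => (hdrift s hs' i ξ).2
    refine continuousOn_Ici_of_forall_Icc fun T => ?_
    obtain ⟨M, hM0, hM⟩ := h.exists_norm_torusCoeff_le T
    refine continuousOn_tsum_kernelMode_mul hs (R := M * M) (fun p s hs' => ?_) (fun p => ?_) i
    · rw [norm_mul]
      exact mul_le_mul (hM s hs' _) (hM s hs' _) (norm_nonneg _) hM0
    · exact ((h.continuousOn_torusCoeff _).mul (h.continuousOn_torusCoeff _)).mono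
        Set.Icc_subset_Ici_self
  · congr 2
    exact Finset.sum_congr rfl fun i _ => by rw [(hdrift t ht i ξ).2]; rfl

/-- The drift is quadratic, so the bound 1 propagates only if some moderate bound is already known.
A continuity argument supplies it: on a short time step, of length uniform in `ξ`, the bound grows
from 1 to at most 2, and `A · 2² ≤ 2πσ` then brings it back to 1. -/
lemma IsMcKeanVlasovSolution.norm_torusCoeff_le_one (hρ : IsMcKeanVlasovSolution σ K ρ₀ ρ)
    (h₀ : IsProbDensity ρ₀) (hσ : 0 < σ) (hA : 4 * kernelMass K ≤ 2 * Real.pi * σ)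
    {t : ℝ} (ht : 0 ≤ t) (ξ : Fin d → ℤ) : ‖torusCoeff (ρ t) ξ‖ ≤ 1 := by
  have h := hρ.equation
  have hpi := Real.pi_pos
  have hinit : ∀ ξ, ‖torusCoeff (ρ 0) ξ‖ ≤ 1 := fun ξ => by
    rw [torusCoeff_congr hρ.initial]; exact h₀.norm_torusCoeff_le_one ξ
  obtain ⟨M, hM0, hM⟩ := h.exists_norm_torusCoeff_le t
  -- Chosen so that `A M² ≤ 2πσL`; the `+ 1` keeps `L` positive when `A M = 0`.
  set L : ℝ := kernelMass K * M ^ 2 / (2 * Real.pi * σ) + 1 with hL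
  have hA0 := kernelMass_nonneg (K := K)
  have hLpos : 0 < L := by positivity
  have hML : kernelMass K * M ^ 2 ≤ 2 * Real.pi * σ * L := by
    rw [hL, mul_add, mul_div_cancel₀ _ (by positivity)]
    nlinarith [mul_pos hpi hσ]
  set α : ℝ := 2 * Real.pi * (Fintype.card (Fin d) * (L * (2 * Real.pi * σ * L))) with hα
  have hα0 : 0 ≤ α := by positivity
  -- `τ` depends only on the crude bound `M` on `[0, t]`, so finitely many steps reach `t`.
  obtain ⟨τ, hτ, hατ⟩ : ∃ τ : ℝ, 0 < τ ∧ α * τ ≤ 1 := by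
    refine ⟨1 / (α + 1), by positivity, ?_⟩
    rw [mul_one_div, div_le_one (by positivity)]
    linarith
  have hstep : ∀ n : ℕ, ∀ s ∈ Set.Icc 0 t, s ≤ n * τ → ∀ ξ, ‖torusCoeff (ρ s) ξ‖ ≤ 1 := by
    intro n
    induction n with
    | zero =>
      intro s hs' hsn ξ
      have : s = 0 := le_antisymm (by simpa using hsn) hs'.1
      rw [this]; exact hinit ξ
    | succ n ih =>
      have htwo : ∀ s ∈ Set.Icc 0 t, s ≤ (n + 1 : ℕ) * τ → ∀ ξ, ‖torusCoeff (ρ s) ξ‖ ≤ 2 := by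
        intro s hs' hsn ξ
        rcases le_total s (n * τ) with hle | hle
        · exact (ih s hs' hle ξ).trans (by norm_num)
        · have hn0 : 0 ≤ n * τ := by positivity
          have := norm_le_of_dissipative (B := 1) (a := n * τ) (b := s) (P := 1)
            (heatRate_nonneg hσ.le ξ) hα0
            ((h.continuousOn_torusCoeff ξ).mono fun r hr => hn0.trans hr.1)
            (fun r hr => hρ.hasDerivWithinAt hK hs ξ (hn0.trans hr.1))
            (fun r hr => by
              rw [mul_one]
              exact norm_divergence_le_add hLpos hML fun i =>
                norm_mcKeanDrift_le hs (hM r ⟨hn0.trans hr.1, hr.2.le.trans hs'.2⟩) ξ i)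
            (ih _ ⟨hn0, hle.trans hs'.2⟩ le_rfl ξ) le_rfl s ⟨hle, le_rfl⟩
          have h2 : s - n * τ ≤ τ := by push_cast at hsn; linarith
          have h3 : α * (s - n * τ) ≤ α * τ := mul_le_mul_of_nonneg_left h2 hα0
          linarith
      intro s hs' hsn ξ
      -- Restarting from time 0, with the bound 2 now known up to `s`, removes the loss `α(s - nτ)`.
      have := norm_le_of_dissipative (B := 1) (a := 0) (b := s) (P := 1) (α := 0)
        (heatRate_nonneg hσ.le ξ) le_rfl
        ((h.continuousOn_torusCoeff ξ).mono Set.Icc_subset_Ici_self)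
        (fun r hr => hρ.hasDerivWithinAt hK hs ξ hr.1)
        (fun r hr => by
          rw [add_zero]
          exact norm_divergence_le (M := kernelMass K * 2 ^ 2) (by linarith) fun i _ =>
            norm_mcKeanDrift_le hs (htwo r ⟨hr.1, hr.2.le.trans hs'.2⟩ (hr.2.le.trans hsn)) ξ i)
        (hinit ξ) le_rfl s ⟨hs'.1, le_rfl⟩
      simpa using this
  obtain ⟨n, hn⟩ := exists_nat_ge (t / τ)
  exact hstep n t ⟨ht, le_rfl⟩ ((div_le_iff₀ hτ).1 hn) ξ

/-- Conservation of mass: at mode 0 both the heat rate and the divergence vanish. -/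
lemma IsMcKeanVlasovSolution.torusCoeff_zero_eq_one (hρ : IsMcKeanVlasovSolution σ K ρ₀ ρ)
    (h₀ : IsProbDensity ρ₀) {t : ℝ} (ht : 0 ≤ t) : torusCoeff (ρ t) 0 = 1 := by
  have h := hρ.equation
  have := norm_le_of_dissipative (u := fun s => torusCoeff (ρ s) 0 - 1) (D := fun _ => 0) (κ := 0)
    (B := 0) (α := 0) (a := 0) (b := t) (P := 0) le_rfl le_rfl
    (((h.continuousOn_torusCoeff 0).mono Set.Icc_subset_Ici_self).sub continuousOn_const)
    (fun s hs' => ((hρ.hasDerivWithinAt hK hs 0 hs'.1).sub_const 1).congr_deriv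
      (by simp [heatRate]))
    (by simp) (by simp [torusCoeff_congr hρ.initial, torusCoeff_zero, h₀.integral_eq_one]) le_rfl
    t ⟨ht, le_rfl⟩
  simpa [sub_eq_zero] using this

end McKeanVlasov

/-! ### A priori bound for the Liouville modes -/

section Liouville

variable {d N : ℕ} {K : UnitAddTorus (Fin d) → UnitAddTorus (Fin d) → EuclideanSpace ℝ (Fin d)}
  {σ : ℝ} {ρ₀ : UnitAddTorus (Fin d) → ℝ} {f : ℝ → Config d (Fin N) → ℝ}

variable (hK : Continuous (fun z : UnitAddTorus (Fin d) × UnitAddTorus (Fin d) => K z.1 z.2))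
  (hs : Summable (fun p : (Fin d → ℤ) × (Fin d → ℤ) => ‖kernelMode K p.1 p.2‖))

include hK hs

lemma IsLiouvilleSolution.hasDerivWithinAt (hf : IsLiouvilleSolution N σ K ρ₀ f)
    (Λ : Fin N × Fin d → ℤ) {t : ℝ} (ht : 0 ≤ t) :
    HasDerivWithinAt (fun s => torusCoeff (f s) Λ)
      (-heatRate σ Λ * torusCoeff (f t) Λ -
        2 * Real.pi * Complex.I * ∑ q, Λ q * liouvilleDrift K (torusCoeff (f t)) Λ q)
      (Set.Ici t) t := by
  have h := hf.equation
  have hdrift := fun s hs' => torusCoeff_liouville_drift hK hs (h.integrable s hs')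
  refine (h.hasDerivWithinAt_torusCoeff Λ (fun s hs' q => (hdrift s hs' q.1 q.2 Λ).1) (fun q => ?_)
    ht).congr_deriv ?_
  · refine ContinuousOn.congr (f := fun s => liouvilleDrift K (torusCoeff (f s)) Λ q) ?_
      fun s hs' => (hdrift s hs' q.1 q.2 Λ).2
    refine continuousOn_Ici_of_forall_Icc fun T => ?_
    obtain ⟨M, hM0, hM⟩ := h.exists_norm_torusCoeff_le T
    refine continuousOn_const.mul (continuousOn_finsetSum _ fun l _ => ?_)
    exact continuousOn_tsum_kernelMode_mul hs (R := M)
      (w := fun p s => torusCoeff (f s) (Λ - pairMode q.1 l p)) (fun p s hs' => hM s hs' _)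
      (fun p => (h.continuousOn_torusCoeff _).mono Set.Icc_subset_Ici_self) q.2
  · congr 2
    exact Finset.sum_congr rfl fun q _ => by rw [(hdrift t ht q.1 q.2 Λ).2]; rfl

/-- The drift is linear in the modes, so any bound `R` on `[0, t]` improves to `max 1 (R/2)`.
Iterating from the crude `L¹` bound `M` gives 1, with no positivity of the solution needed. -/
lemma IsLiouvilleSolution.norm_torusCoeff_le_one (hf : IsLiouvilleSolution N σ K ρ₀ f)
    (hN : 1 ≤ N) (h₀ : ∀ Λ, ‖torusCoeff (f 0) Λ‖ ≤ 1) (hσ : 0 < σ)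
    (hA : 4 * kernelMass K ≤ 2 * Real.pi * σ)
    {t : ℝ} (ht : 0 ≤ t) (Λ : Fin N × Fin d → ℤ) : ‖torusCoeff (f t) Λ‖ ≤ 1 := by
  have h := hf.equation
  obtain ⟨M, hM0, hM⟩ := h.exists_norm_torusCoeff_le t
  have hA0 := kernelMass_nonneg (K := K)
  have hstep : ∀ n : ℕ, ∀ s ∈ Set.Icc 0 t, ∀ Λ, ‖torusCoeff (f s) Λ‖ ≤ max 1 (M / 2 ^ n) := by
    intro n
    induction n with
    | zero => intro s hs' Λ; exact (hM s hs' Λ).trans (by simp)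
    | succ n ih =>
      intro s hs' Λ
      set R := max 1 (M / 2 ^ n) with hR
      have hR0 : 0 < R := zero_lt_one.trans_le (le_max_left _ _)
      have hle : R / 2 ≤ max 1 (M / 2 ^ (n + 1)) := by
        have : M / 2 ^ (n + 1) = M / 2 ^ n / 2 := by rw [pow_succ, div_div]
        rw [this, div_le_iff₀ two_pos, hR]
        refine max_le ?_ ?_
        · have := le_max_left 1 (M / 2 ^ n / 2); linarith
        · have := le_max_right 1 (M / 2 ^ n / 2); linarith
      have hMR : kernelMass K * R ≤ 2 * Real.pi * σ * (R / 2) := by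
        have := mul_le_mul_of_nonneg_right hA (half_pos hR0).le
        linarith [mul_nonneg hA0 hR0.le]
      have := norm_le_of_dissipative (B := R / 2) (a := 0) (b := s) (α := 0)
        (heatRate_nonneg hσ.le Λ) le_rfl
        ((h.continuousOn_torusCoeff Λ).mono Set.Icc_subset_Ici_self)
        (fun r hr => hf.hasDerivWithinAt hK hs Λ hr.1)
        (fun r hr => by
          rw [add_zero]
          exact norm_divergence_le (M := kernelMass K * R) hMR fun q _ =>
            norm_liouvilleDrift_le hs hN (ih r ⟨hr.1, hr.2.le.trans hs'.2⟩) Λ q)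
        ((h₀ Λ).trans (le_max_left _ _)) hle s ⟨hs'.1, le_rfl⟩
      simpa using this
  obtain ⟨n, hn⟩ := pow_unbounded_of_one_lt M one_lt_two
  refine (hstep n t ⟨ht, le_rfl⟩ Λ).trans (max_le le_rfl ?_)
  rw [div_le_one (by positivity)]
  exact hn.le

end Liouville

/-! ### Modes of tensor powers, relabelled coordinates and marginals -/

section Product

variable {d : ℕ} {ι : Type*} [Fintype ι]

lemma measurePreserving_curry_config :
    MeasurePreserving (MeasurableEquiv.curry ι (Fin d) UnitAddCircle)
      (volume : Measure (Config d ι)) (volume : Measure (ι → UnitAddTorus (Fin d))) := by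
  refine ⟨MeasurableEquiv.measurable _, ?_⟩
  have h := Measure.infinitePi_map_curry
    (fun (_ : ι) (_ : Fin d) => (volume : Measure UnitAddCircle))
  simp only [Measure.infinitePi_eq_pi] at h
  exact h

lemma integrable_tensorPower {h : UnitAddTorus (Fin d) → ℝ} (hh : Integrable h volume) :
    Integrable (tensorPower ι h) volume := by
  have h1 : Integrable (fun y : ι → UnitAddTorus (Fin d) => ∏ k, h (y k)) volume :=
    Integrable.fintype_prod (f := fun _ => h) fun _ => hh
  exact measurePreserving_curry_config.integrable_comp_of_integrable h1

lemma torusCoeff_tensorPower (h : UnitAddTorus (Fin d) → ℝ) (Λ : ι × Fin d → ℤ) :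
    torusCoeff (tensorPower ι h) Λ = ∏ k, torusCoeff h fun i => Λ (k, i) := by
  simp only [torusCoeff, UnitAddTorus.mFourierCoeff]
  rw [← integral_fintype_prod_volume_eq_prod, ← measurePreserving_curry_config.integral_comp'
    (f := MeasurableEquiv.curry ι (Fin d) UnitAddCircle)]
  congr 1; ext x
  simp only [UnitAddTorus.mFourier, ContinuousMap.coe_mk, Fintype.prod_prod_type, tensorPower,
    smul_eq_mul, Finset.prod_mul_distrib, Complex.ofReal_prod, Pi.neg_apply]
  rfl

lemma torusCoeff_comp_equiv {J J' : Type*} [Fintype J] [Fintype J'] (e : J ≃ J')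
    (h : UnitAddTorus J → ℝ) (ξ : J' → ℤ) :
    torusCoeff (fun x : UnitAddTorus J' => h fun j => x (e j)) ξ =
      torusCoeff h fun j => ξ (e j) := by
  have hp := volume_measurePreserving_piCongrLeft (fun _ : J' => UnitAddCircle) e
  simp only [torusCoeff, UnitAddTorus.mFourierCoeff]
  rw [← hp.integral_comp' (f := MeasurableEquiv.piCongrLeft (fun _ : J' => UnitAddCircle) e)]
  have hv : ∀ (x : J → UnitAddCircle) j,
      MeasurableEquiv.piCongrLeft (fun _ : J' => UnitAddCircle) e x (e j) = x j := fun x j =>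
    Equiv.piCongrLeft_apply_apply (fun _ : J' => UnitAddCircle) e x j
  congr 1; ext x
  simp only [hv, UnitAddTorus.mFourier, ContinuousMap.coe_mk]
  rw [← e.prod_comp]
  simp only [hv, Pi.neg_apply]

lemma integrable_comp_equiv {J J' : Type*} [Fintype J] [Fintype J'] (e : J ≃ J')
    {h : UnitAddTorus J → ℝ} (hh : Integrable h volume) :
    Integrable (fun x : UnitAddTorus J' => h fun j => x (e j)) volume := by
  have hp := volume_measurePreserving_piCongrLeft (fun _ : J' => UnitAddCircle) e
  rw [← hp.integrable_comp_emb (MeasurableEquiv.measurableEmbedding _)]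
  convert hh using 1
  ext x
  simp only [Function.comp_apply]
  congr 1; ext j
  exact Equiv.piCongrLeft_apply_apply (fun _ : J' => UnitAddCircle) e x j

variable [DecidableEq ι]

/-- The coordinates of the particles in `P` and of the remaining particles. -/
def splitCoords (d : ℕ) (P : Finset ι) :
    (P × Fin d) ⊕ ({k : ι // k ∉ P} × Fin d) ≃ ι × Fin d :=
  (Equiv.sumProdDistrib _ _ _).symm.trans
    ((Equiv.sumCompl fun k => k ∈ P).prodCongr (Equiv.refl _))

lemma measurePreserving_split (P : Finset ι) :
    MeasurePreserving
      ((MeasurableEquiv.sumPiEquivProdPi fun _ => UnitAddCircle).symm.trans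
        (MeasurableEquiv.piCongrLeft (fun _ => UnitAddCircle) (splitCoords d P)))
      (volume : Measure (Config d P × Config d {k : ι // k ∉ P})) (volume : Measure (Config d ι)) :=
  (volume_measurePreserving_sumPiEquivProdPi_symm fun _ => UnitAddCircle).trans
    (volume_measurePreserving_piCongrLeft _ _)

omit [Fintype ι] in
lemma split_apply (P : Finset ι) (z : Config d P × Config d {k : ι // k ∉ P}) :
    ((MeasurableEquiv.sumPiEquivProdPi fun _ => UnitAddCircle).symm.trans
        (MeasurableEquiv.piCongrLeft (fun _ => UnitAddCircle) (splitCoords d P))) z =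
      fun p => if h : p.1 ∈ P then z.1 (⟨p.1, h⟩, p.2) else z.2 (⟨p.1, h⟩, p.2) := by
  ext q
  obtain ⟨s, rfl⟩ := (splitCoords d P).surjective q
  refine (Equiv.piCongrLeft_apply_apply (fun _ : ι × Fin d => UnitAddCircle)
    (splitCoords d P) _ s).trans ?_
  rcases s with ⟨⟨k, hk⟩, i⟩ | ⟨⟨k, hk⟩, i⟩
  · simp [splitCoords, hk]; rfl
  · simp [splitCoords, hk]; rfl

lemma integrable_split {f : Config d ι → ℝ} (hf : Integrable f volume) (P : Finset ι) :
    Integrable (fun z : Config d P × Config d {k : ι // k ∉ P} =>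
      f fun p => if h : p.1 ∈ P then z.1 (⟨p.1, h⟩, p.2) else z.2 (⟨p.1, h⟩, p.2)) volume := by
  have := (measurePreserving_split (d := d) P).integrable_comp_of_integrable hf
  simpa only [Function.comp_def, split_apply] using this

lemma integrable_marginal {f : Config d ι → ℝ} (hf : Integrable f volume) (P : Finset ι) :
    Integrable (marginal f P) volume :=
  Integrable.integral_prod_left (integrable_split hf P)

/-- The extension by zero of a mode of the particles in `P` to all particles. -/
def extendMode (P : Finset ι) (ξ : P × Fin d → ℤ) : ι × Fin d → ℤ :=
  fun q => if h : q.1 ∈ P then ξ (⟨q.1, h⟩, q.2) else 0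

lemma mFourier_extendMode (P : Finset ι) (ξ : P × Fin d → ℤ)
    (z : Config d P × Config d {k : ι // k ∉ P}) :
    UnitAddTorus.mFourier (-extendMode P ξ)
        (fun p => if h : p.1 ∈ P then z.1 (⟨p.1, h⟩, p.2) else z.2 (⟨p.1, h⟩, p.2)) =
      UnitAddTorus.mFourier (-ξ) z.1 := by
  simp only [UnitAddTorus.mFourier, ContinuousMap.coe_mk]
  rw [← (splitCoords d P).prod_comp, Fintype.prod_sum_type]
  have h1 : ∀ a : P × Fin d, splitCoords d P (Sum.inl a) = (a.1.1, a.2) := fun _ => rfl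
  have h2 : ∀ a : {k : ι // k ∉ P} × Fin d, splitCoords d P (Sum.inr a) = (a.1.1, a.2) :=
    fun _ => rfl
  simp only [h1, h2, Pi.neg_apply, extendMode]
  rw [Fintype.prod_eq_one (f := fun a : {k : ι // k ∉ P} × Fin d => _) fun a => by
    simp [a.1.2], mul_one]
  refine Finset.prod_congr rfl fun a _ => ?_
  simp [a.1.2]

/-- Fubini: the character of the extended mode does not see the variables integrated out. -/
lemma torusCoeff_marginal {f : Config d ι → ℝ} (hf : Integrable f volume) (P : Finset ι)
    (ξ : P × Fin d → ℤ) :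
    torusCoeff (marginal f P) ξ = torusCoeff f (extendMode P ξ) := by
  have h1 := (measurePreserving_split (d := d) P).integral_comp'
    (g := fun x => UnitAddTorus.mFourier (-extendMode P ξ) x * (f x : ℂ))
  have h2 := (measurePreserving_split (d := d) P).integrable_comp_of_integrable
    (integrable_mFourier_mul hf (-extendMode P ξ))
  simp only [Function.comp_def, split_apply, mFourier_extendMode] at h1 h2
  simp only [torusCoeff, UnitAddTorus.mFourierCoeff, smul_eq_mul]
  rw [← h1]
  refine Eq.trans ?_ (integral_prod _ h2).symm
  congr 1; ext x
  dsimp only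
  rw [integral_const_mul, integral_complex_ofReal]
  rfl

end Product

/-! ### The hierarchy of mode differences -/

section Hierarchy

variable {d N : ℕ} {K : UnitAddTorus (Fin d) → UnitAddTorus (Fin d) → EuclideanSpace ℝ (Fin d)}
  {σ : ℝ} {ρ₀ : UnitAddTorus (Fin d) → ℝ} {ρ : ℝ → UnitAddTorus (Fin d) → ℝ}
  {f : ℝ → Config d (Fin N) → ℝ}

/-- The mode of the particle `k` in a mode of the whole configuration. -/
def particleMode {ι : Type*} (Λ : ι × Fin d → ℤ) (k : ι) : Fin d → ℤ := fun i => Λ (k, i)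

/-- The set of the particles on which a mode of the configuration depends. -/
def modeSupport (Λ : Fin N × Fin d → ℤ) : Finset (Fin N) :=
  Finset.univ.filter fun k => particleMode Λ k ≠ 0

/-- The Fourier modes of the tensor power of a density with modes `r`. -/
noncomputable def productMode (r : (Fin d → ℤ) → ℂ) (Λ : Fin N × Fin d → ℤ) : ℂ :=
  ∏ k, r (particleMode Λ k)

/-- The Fourier mode of the drift of the tensor power of a McKean-Vlasov solution. -/
noncomputable def productDrift (K : UnitAddTorus (Fin d) → UnitAddTorus (Fin d) →
    EuclideanSpace ℝ (Fin d)) (r : (Fin d → ℤ) → ℂ) (Λ : Fin N × Fin d → ℤ) (q : Fin N × Fin d) :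
    ℂ :=
  (∏ k ∈ Finset.univ.erase q.1, r (particleMode Λ k)) * mcKeanDrift K r (particleMode Λ q.1) q.2

lemma particleMode_sub_pairMode_left {k l : Fin N} (hkl : l ≠ k) (Λ : Fin N × Fin d → ℤ)
    (p : (Fin d → ℤ) × (Fin d → ℤ)) :
    particleMode (Λ - pairMode k l p) k = particleMode Λ k - p.1 := by
  ext i; simp [particleMode, pairMode, hkl.symm]

lemma particleMode_sub_pairMode_right {k l : Fin N} (hkl : l ≠ k) (Λ : Fin N × Fin d → ℤ)
    (p : (Fin d → ℤ) × (Fin d → ℤ)) :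
    particleMode (Λ - pairMode k l p) l = particleMode Λ l - p.2 := by
  ext i; simp [particleMode, pairMode, hkl]

lemma particleMode_sub_pairMode_of_ne {k l m : Fin N} (hk : m ≠ k) (hl : m ≠ l)
    (Λ : Fin N × Fin d → ℤ) (p : (Fin d → ℤ) × (Fin d → ℤ)) :
    particleMode (Λ - pairMode k l p) m = particleMode Λ m := by
  ext i; simp [particleMode, pairMode, hk, hl]

/-- A partner `l` absent from `Λ` contributes `r(0) = 1` before the interaction and `r(-η)` after
it: exactly a term of the mean-field drift. -/
lemma productMode_sub_pairMode {r : (Fin d → ℤ) → ℂ} (hr : r 0 = 1) {k l : Fin N} (hkl : l ≠ k)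
    {Λ : Fin N × Fin d → ℤ} (hl : particleMode Λ l = 0) (p : (Fin d → ℤ) × (Fin d → ℤ)) :
    productMode r (Λ - pairMode k l p) =
      (∏ m ∈ Finset.univ.erase k, r (particleMode Λ m)) *
        (r (particleMode Λ k - p.1) * r (-p.2)) := by
  have hmem : l ∈ Finset.univ.erase k := by simp [hkl]
  rw [productMode, ← Finset.mul_prod_erase _ _ (Finset.mem_univ k),
    ← Finset.mul_prod_erase _ _ hmem, ← Finset.mul_prod_erase _ (fun m => r (particleMode Λ m)) hmem,
    particleMode_sub_pairMode_left hkl, particleMode_sub_pairMode_right hkl, hl, hr, zero_sub]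
  rw [Finset.prod_congr rfl fun m hm => by
    rw [particleMode_sub_pairMode_of_ne (Finset.ne_of_mem_erase (Finset.mem_of_mem_erase hm))
      (Finset.ne_of_mem_erase hm)]]
  ring

/-- Since `k` already belongs to the support, only `l` can be new. -/
lemma card_modeSupport_sub_pairMode_le {k : Fin N} {Λ : Fin N × Fin d → ℤ}
    (hk : k ∈ modeSupport Λ) (l : Fin N) (p : (Fin d → ℤ) × (Fin d → ℤ)) :
    (modeSupport (Λ - pairMode k l p)).card ≤ (modeSupport Λ).card + 1 := by
  refine (Finset.card_le_card ?_).trans (Finset.card_insert_le l (modeSupport Λ))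
  intro m hm
  by_contra hcon
  simp only [Finset.mem_insert, not_or] at hcon
  have hmk : m ≠ k := fun h => hcon.2 (h ▸ hk)
  simp only [modeSupport, Finset.mem_filter, Finset.mem_univ, true_and] at hm hcon
  rw [particleMode_sub_pairMode_of_ne hmk hcon.1] at hm
  exact hcon.2 hm

lemma norm_prod_le_one {α : Type*} (s : Finset α) {w : α → ℂ} (hw : ∀ a, ‖w a‖ ≤ 1) :
    ‖∏ a ∈ s, w a‖ ≤ 1 := by
  rw [norm_prod]
  exact Finset.prod_le_one (fun _ _ => norm_nonneg _) fun a _ => hw a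

lemma heatRate_eq_sum (Λ : Fin N × Fin d → ℤ) :
    heatRate σ Λ = ∑ k, heatRate σ (particleMode Λ k) := by
  simp only [heatRate, Fintype.sum_prod_type, Finset.mul_sum]
  rfl

variable (hs : Summable (fun p : (Fin d → ℤ) × (Fin d → ℤ) => ‖kernelMode K p.1 p.2‖))

include hs

/-- The mean-field drift does not depend on `l`, so it can be put under the average over partners.
Partners in the support of `Λ`, among them `l = k`, are bounded trivially by 2; the others see a
difference of the hierarchy with at most one more particle. -/
lemma norm_liouvilleDrift_sub_productDrift_le (hN : 1 ≤ N) {F : (Fin N × Fin d → ℤ) → ℂ}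
    {r : (Fin d → ℤ) → ℂ} {H : ℝ} {Λ : Fin N × Fin d → ℤ} (hF : ∀ Λ, ‖F Λ‖ ≤ 1)
    (hr : ∀ ξ, ‖r ξ‖ ≤ 1) (hr0 : r 0 = 1) (hH0 : 0 ≤ H)
    (hH : ∀ Λ', (modeSupport Λ').card ≤ (modeSupport Λ).card + 1 → ‖F Λ' - productMode r Λ'‖ ≤ H)
    {q : Fin N × Fin d} (hq : Λ q ≠ 0) :
    ‖liouvilleDrift K F Λ q - productDrift K r Λ q‖ ≤
      kernelMass K * (2 * (modeSupport Λ).card / N + H) := by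
  obtain ⟨k, i⟩ := q
  have hN0 : (N : ℂ) ≠ 0 := by exact_mod_cast (Nat.pos_iff_ne_zero.1 hN)
  have hNr : (0 : ℝ) < N := by exact_mod_cast hN
  have hk : k ∈ modeSupport Λ := by
    simp only [modeSupport, Finset.mem_filter, Finset.mem_univ, true_and]
    exact fun h => hq (congrFun h i)
  set E : ℂ := ∏ m ∈ Finset.univ.erase k, r (particleMode Λ m) with hE
  have hE1 : ‖E‖ ≤ 1 := norm_prod_le_one _ fun m => hr _
  set w : Fin N → (Fin d → ℤ) × (Fin d → ℤ) → ℂ := fun l p =>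
    F (Λ - pairMode k l p) - E * (r (particleMode Λ k - p.1) * r (-p.2)) with hw
  have hEr : ∀ p : (Fin d → ℤ) × (Fin d → ℤ), ‖E * (r (particleMode Λ k - p.1) * r (-p.2))‖ ≤ 1 := by
    intro p
    rw [norm_mul, norm_mul]
    exact mul_le_one₀ hE1 (by positivity) (mul_le_one₀ (hr _) (norm_nonneg _) (hr _))
  have hwle : ∀ l p, ‖w l p‖ ≤ (if l ∈ modeSupport Λ then 2 else 0) + H := by
    intro l p
    by_cases hl : l ∈ modeSupport Λ
    · have := norm_sub_le (F (Λ - pairMode k l p)) (E * (r (particleMode Λ k - p.1) * r (-p.2)))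
      simp only [hl, if_true]
      linarith [hF (Λ - pairMode k l p), hEr p]
    · have hlk : l ≠ k := fun h => hl (h ▸ hk)
      have hl0 : particleMode Λ l = 0 := by simpa [modeSupport] using hl
      simp only [hl, if_false, zero_add, hw, hE]
      rw [← productMode_sub_pairMode hr0 hlk hl0]
      exact hH _ (card_modeSupport_sub_pairMode_le hk l p)
  have heq : liouvilleDrift K F Λ (k, i) - productDrift K r Λ (k, i) =
      (1 / (N : ℂ)) * ∑ l : Fin N, ∑' p : (Fin d → ℤ) × (Fin d → ℤ),
        kernelMode K p.1 p.2 i * w l p := by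
    have h1 : ∀ l : Fin N, ∑' p : (Fin d → ℤ) × (Fin d → ℤ), kernelMode K p.1 p.2 i * w l p =
        ∑' p : (Fin d → ℤ) × (Fin d → ℤ), kernelMode K p.1 p.2 i * F (Λ - pairMode k l p) -
          productDrift K r Λ (k, i) := by
      intro l
      have h2 : productDrift K r Λ (k, i) = ∑' p : (Fin d → ℤ) × (Fin d → ℤ),
          kernelMode K p.1 p.2 i * (E * (r (particleMode Λ k - p.1) * r (-p.2))) := by
        rw [productDrift, mcKeanDrift, ← tsum_mul_left]
        exact tsum_congr fun p => by ring
      rw [h2, ← Summable.tsum_sub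
        (summable_kernelMode_mul hs (w := fun p => F (Λ - pairMode k l p)) (fun p => hF _) i)
        (summable_kernelMode_mul hs hEr i)]
      exact tsum_congr fun p => by simp only [hw]; ring
    simp only [h1, Finset.sum_sub_distrib, Finset.sum_const, Finset.card_univ, Fintype.card_fin,
      nsmul_eq_mul, liouvilleDrift]
    field_simp
  rw [heq]
  refine (norm_average_tsum_le hs hN hwle i).trans_eq ?_
  congr 1
  rw [Finset.sum_add_distrib]
  simp only [Finset.sum_ite_mem, Finset.univ_inter, Finset.sum_const, Finset.card_univ,
    Fintype.card_fin, nsmul_eq_mul]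
  field_simp

variable (hK : Continuous (fun z : UnitAddTorus (Fin d) × UnitAddTorus (Fin d) => K z.1 z.2))

include hK

/-- Leibniz rule: heat rates add up over the particles, and each particle contributes its own
mean-field drift. -/
lemma IsMcKeanVlasovSolution.hasDerivWithinAt_productMode
    (hρ : IsMcKeanVlasovSolution σ K ρ₀ ρ) (Λ : Fin N × Fin d → ℤ) {t : ℝ} (ht : 0 ≤ t) :
    HasDerivWithinAt (fun s => productMode (torusCoeff (ρ s)) Λ)
      (-heatRate σ Λ * productMode (torusCoeff (ρ t)) Λ -
        2 * Real.pi * Complex.I * ∑ q, Λ q * productDrift K (torusCoeff (ρ t)) Λ q)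
      (Set.Ici t) t := by
  have h1 := HasDerivWithinAt.fun_finsetProd (u := (Finset.univ : Finset (Fin N)))
    fun k _ => hρ.hasDerivWithinAt hK hs (particleMode Λ k) ht
  refine h1.congr_deriv ?_
  rw [heatRate_eq_sum, Fintype.sum_prod_type]
  push_cast
  rw [← Finset.sum_neg_distrib, Finset.sum_mul, Finset.mul_sum, ← Finset.sum_sub_distrib]
  refine Finset.sum_congr rfl fun k _ => ?_
  rw [productMode, ← Finset.mul_prod_erase _ _ (Finset.mem_univ k), smul_eq_mul, mul_sub]
  congr 1
  · ring
  · rw [mul_left_comm, Finset.mul_sum]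
    congr 1
    refine Finset.sum_congr rfl fun i _ => ?_
    simp only [productDrift, particleMode]
    ring

theorem norm_torusCoeff_sub_productMode_le (hN : 1 ≤ N) (h₀ : IsProbDensity ρ₀)
    (hρ : IsMcKeanVlasovSolution σ K ρ₀ ρ) (hf : IsLiouvilleSolution N σ K ρ₀ f)
    (hσ : 0 < σ) (hA : 4 * kernelMass K ≤ 2 * Real.pi * σ) {t : ℝ} (ht : 0 ≤ t)
    (Λ : Fin N × Fin d → ℤ) :
    ‖torusCoeff (f t) Λ - productMode (torusCoeff (ρ t)) Λ‖ ≤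
      2 * ((modeSupport Λ).card + 1) / N := by
  have hNr : (0 : ℝ) < N := by exact_mod_cast hN
  have hA0 := kernelMass_nonneg (K := K)
  have hr : ∀ t, 0 ≤ t → ∀ ξ, ‖torusCoeff (ρ t) ξ‖ ≤ 1 := fun t ht ξ =>
    hρ.norm_torusCoeff_le_one hK hs h₀ hσ hA ht ξ
  have hinit : ∀ Λ, torusCoeff (f 0) Λ = productMode (torusCoeff ρ₀) Λ := fun Λ => by
    rw [torusCoeff_congr hf.initial, torusCoeff_tensorPower]; rfl
  have hF : ∀ t, 0 ≤ t → ∀ Λ, ‖torusCoeff (f t) Λ‖ ≤ 1 := fun t ht Λ =>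
    hf.norm_torusCoeff_le_one hK hs hN (fun Λ => by
      rw [hinit]; exact norm_prod_le_one _ fun k => h₀.norm_torusCoeff_le_one _) hσ hA ht Λ
  -- Every level of the hierarchy and every time are treated together, since step `n + 1` at level
  -- `c` uses step `n` at level `c + 1`.
  have hstep : ∀ n : ℕ, ∀ t, 0 ≤ t → ∀ Λ : Fin N × Fin d → ℤ, ∀ m : ℕ,
      (modeSupport Λ).card ≤ m → ‖torusCoeff (f t) Λ - productMode (torusCoeff (ρ t)) Λ‖ ≤
        2 * (m + 1) / N + 2 / 2 ^ n := by
    intro n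
    induction n with
    | zero =>
      intro t ht Λ m _
      have h1 := norm_sub_le (torusCoeff (f t) Λ) (productMode (torusCoeff (ρ t)) Λ)
      have h2 : ‖productMode (torusCoeff (ρ t)) Λ‖ ≤ 1 := norm_prod_le_one _ fun k => hr t ht _
      have h3 : (0 : ℝ) ≤ 2 * (m + 1) / N := by positivity
      have h4 := hF t ht Λ
      simp only [pow_zero, div_one]
      linarith
    | succ n ih =>
      intro t ht Λ m hm
      set c : ℕ := (modeSupport Λ).card
      set H : ℝ := 2 * ((c + 1 : ℕ) + 1) / N + 2 / 2 ^ n with hH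
      have hH0 : 0 ≤ H := by positivity
      have hc0 : (0 : ℝ) ≤ 2 * c / N := by positivity
      have hdiss := norm_le_of_dissipative
        (u := fun s => torusCoeff (f s) Λ - productMode (torusCoeff (ρ s)) Λ)
        (D := fun s => 2 * Real.pi * Complex.I * ∑ q, Λ q *
          (liouvilleDrift K (torusCoeff (f s)) Λ q - productDrift K (torusCoeff (ρ s)) Λ q))
        (κ := heatRate σ Λ) (B := (2 * c / N + H) / 2) (α := 0) (a := 0) (b := t)
        (P := (2 * c / N + H) / 2) (heatRate_nonneg hσ.le Λ) le_rfl
        (((hf.equation.continuousOn_torusCoeff Λ).sub (continuousOn_finsetProd _ fun k _ =>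
          hρ.equation.continuousOn_torusCoeff _)).mono Set.Icc_subset_Ici_self)
        (fun s hs' => ((hf.hasDerivWithinAt hK hs Λ hs'.1).sub
          (hρ.hasDerivWithinAt_productMode hs hK Λ hs'.1)).congr_deriv (by
            simp only [mul_sub, Finset.sum_sub_distrib]; ring))
        (fun s hs' => by
          rw [add_zero]
          refine norm_divergence_le (M := kernelMass K * (2 * c / N + H)) ?_ fun q hq =>
            norm_liouvilleDrift_sub_productDrift_le hs hN (hF s hs'.1) (hr s hs'.1)
              (hρ.torusCoeff_zero_eq_one hK hs h₀ hs'.1) hH0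
              (fun Λ' hΛ' => ih s hs'.1 Λ' _ hΛ') hq
          have hX : 0 ≤ 2 * c / N + H := by positivity
          have h2 := mul_le_mul_of_nonneg_right hA hX
          have h3 : 0 ≤ kernelMass K * (2 * c / N + H) := mul_nonneg hA0 hX
          linarith)
        (by
          rw [hinit]
          simp only [productMode, torusCoeff_congr hρ.initial, sub_self, norm_zero]
          positivity) le_rfl t ⟨ht, le_rfl⟩
      rw [zero_mul, add_zero] at hdiss
      refine hdiss.trans ?_
      have hcm : (c : ℝ) ≤ m := by exact_mod_cast hm
      -- The profile `2(c+1)/N` is the fixed point of the recursion `D_c = (2c/N + D_{c+1})/2`, so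
      -- only the error `2/2^n` is halved.
      have h1 : (2 * (c : ℝ) / N + H) / 2 = 2 * (c + 1) / N + 2 / 2 ^ (n + 1) := by
        rw [hH, pow_succ]; push_cast; field_simp; ring
      rw [h1]
      gcongr
  have hlim : Filter.Tendsto (fun n : ℕ => 2 * (((modeSupport Λ).card : ℝ) + 1) / N + 2 / 2 ^ n)
      Filter.atTop (nhds (2 * ((modeSupport Λ).card + 1) / N + 0)) := by
    refine tendsto_const_nhds.add ?_
    exact tendsto_const_nhds.div_atTop (tendsto_pow_atTop_atTop_of_one_lt one_lt_two)
  rw [add_zero] at hlim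
  exact ge_of_tendsto' hlim fun n => hstep n t ht Λ _ le_rfl

end Hierarchy

/-! ### Marginals, the first correlation function and the theorem -/

section Conclusion

variable {d N : ℕ}

lemma card_firstParticles_le (N j : ℕ) : (firstParticles N j).card ≤ j := by
  have h : (firstParticles N j).card ≤ (Finset.range j).card :=
    Finset.card_le_card_of_injOn Fin.val (fun k hk => by
      simpa [firstParticles] using hk) Fin.val_injective.injOn
  simpa using h

lemma modeSupport_extendMode_subset (P : Finset (Fin N)) (ξ : P × Fin d → ℤ) :
    modeSupport (extendMode P ξ) ⊆ P := by
  intro k hk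
  by_contra hkP
  simp only [modeSupport, Finset.mem_filter, Finset.mem_univ, true_and] at hk
  exact hk (by ext i; simp [particleMode, extendMode, hkP])

lemma productMode_extendMode {r : (Fin d → ℤ) → ℂ} (hr : r 0 = 1) (P : Finset (Fin N))
    (ξ : P × Fin d → ℤ) :
    productMode r (extendMode P ξ) = ∏ k : P, r (particleMode ξ k) := by
  rw [productMode, ← Finset.prod_subset (Finset.subset_univ P), ← Finset.prod_coe_sort]
  · refine Finset.prod_congr rfl fun k _ => ?_
    congr 1; ext i; simp [particleMode, extendMode]
  · intro k _ hk
    have : particleMode (extendMode P ξ) k = 0 := by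
      ext i; simp [particleMode, extendMode, hk]
    rw [this, hr]

lemma hatNorm_le_of_norm_torusCoeff_le {J : Type*} [Fintype J] {h : UnitAddTorus J → ℝ} {a : ℝ}
    (H : ∀ ξ, ‖torusCoeff h ξ‖ ≤ a) : hatNorm h ≤ ENNReal.ofReal a :=
  iSup_le fun ξ => by
    rw [← ofReal_norm]
    exact ENNReal.ofReal_le_ofReal (H ξ)

/-- A one-element set has a single partition, whose coefficient is `(-1)^0 · 0! = 1`. -/
lemma correlation_of_isAtom {ι : Type*} [Fintype ι] [DecidableEq ι] (f : Config d ι → ℝ)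
    {P : Finset ι} (hP : IsAtom P) : correlation f P = marginal f P := by
  ext x
  let _ : Unique (Finpartition P) :=
    IsAtom.uniqueFinpartition (P := Finpartition.indiscrete hP.1) hP
  rw [correlation, Fintype.sum_unique]
  have hparts : (default : Finpartition P).parts = {P} := rfl
  generalize (default : Finpartition P) = π at hparts
  have hmem : P ∈ π.parts := by simp [hparts]
  rw [Finset.prod_eq_single (⟨P, hmem⟩ : π.parts)]
  · simp [hparts]
  · intro Q _ hQ
    exact absurd (Subtype.ext (by simpa [hparts] using Q.2)) hQ
  · simp

lemma firstParticles_one (hN : 1 ≤ N) : firstParticles N 1 = {⟨0, hN⟩} := by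
  ext k; simp [firstParticles, Fin.ext_iff]

end Conclusion

theorem mainTheorem4 :
    ∃ (C₁ : ℝ) (c : ℕ → ℝ),
      ∀ (d : ℕ)
        (K : UnitAddTorus (Fin d) → UnitAddTorus (Fin d) → EuclideanSpace ℝ (Fin d)),
        Continuous (fun z : UnitAddTorus (Fin d) × UnitAddTorus (Fin d) => K z.1 z.2) →
        Summable (fun p : (Fin d → ℤ) × (Fin d → ℤ) => ‖kernelMode K p.1 p.2‖) →
        ∃ C : ℝ, ∀ (σ : ℝ), C < σ →
          ∀ (ρ₀ : UnitAddTorus (Fin d) → ℝ),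
            IsProbDensity ρ₀ → MemLp ρ₀ 2 volume →
          ∀ (ρ : ℝ → UnitAddTorus (Fin d) → ℝ), IsMcKeanVlasovSolution σ K ρ₀ ρ →
          ∀ (N : ℕ), 1 ≤ N →
          ∀ (f : ℝ → Config d (Fin N) → ℝ), IsLiouvilleSolution N σ K ρ₀ f →
          ∀ (t : ℝ), 0 ≤ t →
            hatNorm (fun x : UnitAddTorus (Fin d) =>
                correlation (f t) (firstParticles N 1) (fun p => x p.2) - ρ t x)
              ≤ ENNReal.ofReal (C₁ / N) ∧
            ∀ (j : ℕ), 1 ≤ j → j ≤ N →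
              hatNorm (fun x : Config d (firstParticles N j) =>
                  marginal (f t) (firstParticles N j) x
                    - tensorPower (firstParticles N j) (ρ t) x)
                ≤ ENNReal.ofReal (c j / N) := by
  -- `σ > 2A/π` implies the smallness condition `4A ≤ 2πσ`. A mode of the `j`-particle marginal
  -- involves at most `j` particles, whence `2(j+1)`; the constant 4 is its value at `j = 1`.
  refine ⟨4, fun j => 2 * (j + 1), fun d K hK hs => ⟨2 * kernelMass K / Real.pi, ?_⟩⟩
  intro σ hC ρ₀ h₀ _ ρ hρ N hN f hf t ht
  have hA0 := kernelMass_nonneg (K := K)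
  have hσ : 0 < σ := lt_of_le_of_lt (div_nonneg (by linarith) Real.pi_pos.le) hC
  have hA : 4 * kernelMass K ≤ 2 * Real.pi * σ := by
    rw [div_lt_iff₀ Real.pi_pos] at hC
    linarith
  have hr0 := hρ.torusCoeff_zero_eq_one hK hs h₀ ht
  have hfi := hf.equation.integrable t ht
  have hρi := hρ.equation.integrable t ht
  have key : ∀ j (ξ : firstParticles N j × Fin d → ℤ),
      ‖torusCoeff (marginal (f t) (firstParticles N j)) ξ -
        ∏ k, torusCoeff (ρ t) (particleMode ξ k)‖ ≤ 2 * (j + 1) / N := by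
    intro j ξ
    rw [torusCoeff_marginal hfi, ← productMode_extendMode hr0]
    refine (norm_torusCoeff_sub_productMode_le hs hK hN h₀ hρ hf hσ hA ht _).trans ?_
    have : ((modeSupport (extendMode (firstParticles N j) ξ)).card : ℝ) ≤ j := by
      exact_mod_cast (Finset.card_le_card (modeSupport_extendMode_subset _ ξ)).trans
        (card_firstParticles_le N j)
    gcongr
  refine ⟨?_, fun j _ _ => ?_⟩
  · refine hatNorm_le_of_norm_torusCoeff_le fun ξ => ?_
    have hP := firstParticles_one hN
    rw [correlation_of_isAtom _ (hP ▸ Finset.isAtom_singleton _)]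
    -- The label set of the first particle is a singleton, so its configuration space is identified
    -- with `𝕋^d`.
    let _ : Unique (firstParticles N 1) := hP ▸ inferInstance
    let e : firstParticles N 1 × Fin d ≃ Fin d := Equiv.uniqueProd _ _
    have hi : Integrable (fun x : UnitAddTorus (Fin d) =>
        marginal (f t) (firstParticles N 1) fun p => x p.2) volume :=
      integrable_comp_equiv e (integrable_marginal hfi _)
    have hc : torusCoeff (fun x : UnitAddTorus (Fin d) =>
        marginal (f t) (firstParticles N 1) fun p => x p.2) ξ =
        torusCoeff (marginal (f t) (firstParticles N 1)) fun p => ξ p.2 :=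
      torusCoeff_comp_equiv e _ ξ
    have h1 := key 1 fun p => ξ p.2
    rw [← hc, Fintype.prod_unique] at h1
    rw [torusCoeff_sub hi hρi]
    refine h1.trans_eq ?_
    norm_num
  · refine hatNorm_le_of_norm_torusCoeff_le fun ξ => ?_
    rw [torusCoeff_sub (integrable_marginal hfi _) (integrable_tensorPower hρi),
      torusCoeff_tensorPower]
    exact key j ξ
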